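/- Let $G$ be a finite simple graph with an arbitrary edge-colouring. For a vertex $v$, the colour degree $d^c(v)$ is the number of distinct colours on the edges incident to $v$, and $\delta^c(G)=\min_{v\in V(G)} d^c(v)$. A rainbow $K_3$ is a triangle of $G$ whose three edges have distinct colours. For $S\subseteq V(G)$, a perfect rainbow-$K_3$-tiling of the induced subgraph $G[S]$ is a collection of pairwise vertex-disjoint rainbow copies of $K_3$ in $G[S]$ that together cover every vertex of $S$ (colours may repeat between different copies). For every $\varepsilon>0$ there exists $\varphi_0>0$ such that for every $\varphi\in(0,\varphi_0]$ there exists $n_0\in\mathbb{N}$ such that the following holds for every $n\ge n_0$. If $G$ is an edge-coloured graph on $n$ vertices with $\delta^c(G)\ge(2/3+\varepsilon)n$, then there exists $W\subseteq V(G)$ with $|W|\le\varepsilon n$ such that $G[W]$ has a perfect rainbow-$K_3$-tiling and, for every $U\subseteq V(G)\setminus W$ with $|U|\le\varphi n$ and $3\mid |U|$, $G[U\cup W]$ has a perfect rainbow-$K_3$-tiling. -/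

import Mathlib

namespace RainbowTiling

variable {V K : Type*} {G : SimpleGraph V}

/-- The colour degree of `v`: the number of distinct colours on edges incident to `v`. -/
noncomputable def colourDegree (c : G.EdgeLabeling K) (v : V) : ℕ :=
  Set.ncard {k : K | ∃ e : G.edgeSet, v ∈ (e : Sym2 V) ∧ c e = k}

/-- The minimum colour degree of the edge-coloured graph `(G, c)`. -/
noncomputable def minColourDegree (c : G.EdgeLabeling K) : ℕ :=
  ⨅ v : V, colourDegree c v

/-- `T` is the vertex set of a rainbow `K_r`: it is an `r`-clique of `G`, and the edges of `G`
with both ends in `T` have pairwise distinct colours. -/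
def IsRainbowClique (c : G.EdgeLabeling K) (r : ℕ) (T : Finset V) : Prop :=
  G.IsNClique r T ∧
    ∀ e f : G.edgeSet, (∀ v ∈ (e : Sym2 V), v ∈ T) → (∀ v ∈ (f : Sym2 V), v ∈ T) →
      c e = c f → e = f

/-- The edge-coloured graph `G[S]` has a perfect rainbow-`K_r`-tiling: there are pairwise
vertex-disjoint rainbow copies of `K_r` whose vertex sets together cover exactly `S`.
Colours may repeat between different copies. -/
def HasPerfectRainbowTiling (c : G.EdgeLabeling K) (r : ℕ) (S : Finset V) : Prop :=
  ∃ P : Finset (Finset V),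
    (∀ T ∈ P, IsRainbowClique c r T) ∧
    (∀ T ∈ P, ∀ T' ∈ P, T ≠ T' → Disjoint T T') ∧
    (∀ v : V, v ∈ S ↔ ∃ T ∈ P, v ∈ T)

end RainbowTiling

/-!
Select at each vertex one neighbour for every colour that does not occur too often. This gives a
digraph on `V` all of whose out-degrees exceed `(2/3 + δ) n`, and by Chernoff's inequality a random
`M`-tuple of vertices inherits this and has no accidental colour coincidences, with positive
probability. In a digraph of such out-degree the indicator vectors of the out-triangles generate a
lattice containing all differences of unit vectors. Hence for any three vertices there is an
exchange identity: some multiset of rainbow triangles covers every vertex as often as another one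
together with three edges, each of which completes one of the given vertices to a rainbow triangle.
Blowing up the tuples that realize a fixed identity yields, for every triple of vertices, a
positive proportion of tuples of bounded length that absorb it. Adding at each step a tuple that
decreases the potential `∑ 2 ^ (-number of chosen absorbers)` over all triples produces a small
disjoint family with linearly many absorbers of every triple; a small set `U` is then absorbed
triple by triple.
-/

namespace RainbowTiling

open Finset
open scoped BigOperators

section Lattice

variable {V : Type*} [DecidableEq V] {E : Set (Finset V)} {x y z : V}

/-- The indicator vector of a finite set, with integer coordinates. -/
def indicatorVec (T : Finset V) : V → ℤ := ∑ x ∈ T, Pi.single x 1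

/-- The integer lattice spanned by the indicator vectors of the members of a family. -/
def spanLattice (E : Set (Finset V)) : Submodule ℤ (V → ℤ) :=
  Submodule.span ℤ (indicatorVec '' E)

/-- The vertices `x` and `y` are linked by the family `E` if the difference of their unit vectors
lies in the lattice of `E`: the members of `E` can then exchange `x` for `y`. -/
def Linked (E : Set (Finset V)) (x y : V) : Prop :=
  (Pi.single x 1 - Pi.single y 1 : V → ℤ) ∈ spanLattice E

lemma Linked.refl (E : Set (Finset V)) (x : V) : Linked E x x := by
  simp [Linked]

lemma Linked.symm (h : Linked E x y) : Linked E y x := by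
  simpa [Linked] using (spanLattice E).neg_mem h

lemma Linked.trans (h : Linked E x y) (h' : Linked E y z) : Linked E x z := by
  simpa [Linked] using (spanLattice E).add_mem h h'

lemma indicatorVec_triple (h : #{x, y, z} = 3) :
    indicatorVec {x, y, z} = Pi.single x 1 + Pi.single y 1 + Pi.single z 1 := by
  obtain ⟨hxy, hxz, hyz⟩ := card_triple_eq_three_iff.1 h
  rw [indicatorVec, sum_insert (by simp [hxy, hxz]), sum_insert (by simp [hyz]), sum_singleton,
    add_assoc]

lemma Linked.of_triples {a b a' b' : V} (hx : {a, b, x} ∈ E) (hy : {a', b', y} ∈ E)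
    (hx3 : #{a, b, x} = 3) (hy3 : #{a', b', y} = 3) (ha : Linked E a a') (hb : Linked E b b') :
    Linked E x y := by
  have hx_mem : indicatorVec {a, b, x} ∈ spanLattice E :=
    Submodule.subset_span (Set.mem_image_of_mem _ hx)
  have hy_mem : indicatorVec {a', b', y} ∈ spanLattice E :=
    Submodule.subset_span (Set.mem_image_of_mem _ hy)
  rw [indicatorVec_triple hx3] at hx_mem
  rw [indicatorVec_triple hy3] at hy_mem
  rw [Linked]
  convert sub_mem (sub_mem (sub_mem hx_mem hy_mem) ha) hb using 1
  abel

end Lattice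

section Digraph

variable {V : Type*}

lemma card_add_card_le_of_disjoint {A B W : Finset V} (hA : A ⊆ W) (hB : B ⊆ W)
    (h : Disjoint A B) : #A + #B ≤ #W := by
  classical
  rw [← card_union_of_disjoint h]
  exact card_le_card (union_subset hA hB)

variable [DecidableEq V] {S : V → Finset V}

lemma card_add_card_le_card_inter_add {A B W : Finset V} (hA : A ⊆ W) (hB : B ⊆ W) :
    #A + #B ≤ #(A ∩ B) + #W := by
  have h_union := card_union_add_card_inter A B
  have h_le := card_le_card (union_subset hA hB)
  omega

/-- In the digraph with out-neighbourhoods `S`, the set `T` consists of three pairwise adjacent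
vertices, each of which has an out-neighbour in `T`. -/
def OutTriangle (S : V → Finset V) (T : Finset V) : Prop :=
  #T = 3 ∧ (∀ x ∈ T, ∀ y ∈ T, x ≠ y → y ∈ S x ∨ x ∈ S y) ∧ ∀ x ∈ T, ∃ y ∈ T, y ∈ S x

/-- The in-neighbours of `b` inside `A`, in the digraph with out-neighbourhoods `S`. -/
def inNbrs (S : V → Finset V) (A : Finset V) (b : V) : Finset V := {v ∈ A | b ∈ S v}

lemma mem_inNbrs {A : Finset V} {b v : V} : v ∈ inNbrs S A b ↔ v ∈ A ∧ b ∈ S v := mem_filter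

lemma inNbrs_subset (S : V → Finset V) (A : Finset V) (b : V) : inNbrs S A b ⊆ A :=
  filter_subset _ _

lemma OutTriangle.of_cycle (hS : ∀ v, v ∉ S v) {a b c : V} (hab : b ∈ S a) (hbc : c ∈ S b)
    (hca : a ∈ S c) : OutTriangle S {a, b, c} := by
  have hne : ∀ {v w}, w ∈ S v → v ≠ w := by rintro v _ h rfl; exact hS v h
  refine ⟨card_triple_eq_three_iff.2 ⟨hne hab, (hne hca).symm, hne hbc⟩, ?_, ?_⟩
  · simp only [mem_insert, mem_singleton]
    rintro x (rfl | rfl | rfl) y (rfl | rfl | rfl) <;> simp_all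
  · simp only [mem_insert, mem_singleton]
    rintro x (rfl | rfl | rfl) <;> simp_all

lemma OutTriangle.of_double (hS : ∀ v, v ∉ S v) {a b w : V} (hab : b ∈ S a) (hba : a ∈ S b)
    (hwb : b ∈ S w) (hwa : a ∈ S w ∨ w ∈ S a) : OutTriangle S {a, b, w} := by
  have hne : ∀ {v w}, w ∈ S v → v ≠ w := by rintro v _ h rfl; exact hS v h
  have haw : a ≠ w := hwa.elim (fun h => (hne h).symm) hne
  refine ⟨card_triple_eq_three_iff.2 ⟨hne hab, haw, (hne hwb).symm⟩, ?_, ?_⟩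
  · simp only [mem_insert, mem_singleton]
    rintro x (rfl | rfl | rfl) y (rfl | rfl | rfl) <;> simp_all [hwa.symm]
  · simp only [mem_insert, mem_singleton]
    rintro x (rfl | rfl | rfl) <;> simp_all

lemma sum_card_inter_eq_sum_card_inNbrs (S : V → Finset V) (A : Finset V) :
    ∑ v ∈ A, #(A ∩ S v) = ∑ b ∈ A, #(inNbrs S A b) := by
  simpa [bipartiteAbove, bipartiteBelow, inNbrs, filter_mem_eq_inter] using
    sum_card_bipartiteAbove_eq_sum_card_bipartiteBelow (s := A) (t := A) (fun v b => b ∈ S v)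

lemma two_mul_sum_card_inter_le_sq {A : Finset V}
    (hA : ∀ a ∈ A, ∀ b ∈ A, a ∈ S b → b ∉ S a) : 2 * ∑ v ∈ A, #(A ∩ S v) ≤ #A ^ 2 := by
  have h_le : ∑ v ∈ A, (#(A ∩ S v) + #(inNbrs S A v)) ≤ ∑ _v ∈ A, #A := by
    refine sum_le_sum fun v hv => card_add_card_le_of_disjoint inter_subset_left
      (inNbrs_subset S A v) (disjoint_left.2 fun z hz hz' => ?_)
    rw [mem_inter] at hz
    exact hA z hz.1 v hv hz.2 (mem_inNbrs.1 hz').2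
  rw [sum_add_distrib, ← sum_card_inter_eq_sum_card_inNbrs, sum_const, smul_eq_mul] at h_le
  linarith

/-- No out-triangle meets `W` in exactly two vertices. For `W` a class of linked vertices that
contains two vertices of some out-triangle, this expresses that the class cannot be enlarged. -/
def TriangleClosed (S : V → Finset V) (W : Finset V) : Prop :=
  ∀ p ∈ W, ∀ q ∈ W, ∀ x ∉ W, ¬ OutTriangle S {p, q, x}

lemma TriangleClosed.notMem_of_double {W : Finset V} (hW : TriangleClosed S W)
    (hS : ∀ v, v ∉ S v) {b c y : V} (hb : b ∈ W) (hc : c ∈ W) (hy : y ∉ W)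
    (hyb : b ∈ S y) (hbc : c ∈ S b) (hcb : b ∈ S c) : c ∉ S y := fun hyc =>
  hW c hc b hb y hy (OutTriangle.of_double hS hcb hbc hyb (Or.inl hyc))

variable [Fintype V]

section LargeOutDegree

variable (hdeg : ∀ v, 2 * Fintype.card V < 3 * #(S v))
include hdeg

lemma three_mul_card_lt_card_inter_add (A : Finset V) (v : V) :
    3 * #A < 3 * #(A ∩ S v) + Fintype.card V := by
  have h_le := card_add_card_le_card_inter_add (subset_univ A) (subset_univ (S v))
  have hv := hdeg v
  rw [card_univ] at h_le
  omega

lemma exists_double_of_inNbrs {A : Finset V} {b : V} (hb : Fintype.card V ≤ 3 * #(inNbrs S A b)) :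
    ∃ a ∈ A, a ∈ S b ∧ b ∈ S a := by
  by_contra! hcon
  have hdisj : Disjoint (inNbrs S A b) (A ∩ S b) := disjoint_left.2 fun a ha ha' =>
    hcon a (mem_of_mem_inter_left ha') (mem_of_mem_inter_right ha') (mem_inNbrs.1 ha).2
  have h_le := card_add_card_le_of_disjoint (inNbrs_subset S A b) inter_subset_left hdisj
  have h_lt := three_mul_card_lt_card_inter_add hdeg A b
  omega

lemma exists_inNbrs_large {A : Finset V} (hA : A.Nonempty) :
    ∃ b ∈ A, 3 * #A < 3 * #(inNbrs S A b) + Fintype.card V := by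
  refine exists_lt_of_sum_lt (f := fun _ => 3 * #A)
    (g := fun b => 3 * #(inNbrs S A b) + Fintype.card V) ?_
  calc ∑ _v ∈ A, 3 * #A < ∑ v ∈ A, (3 * #(A ∩ S v) + Fintype.card V) :=
        sum_lt_sum_of_nonempty hA fun v _ => three_mul_card_lt_card_inter_add hdeg A v
    _ = ∑ b ∈ A, (3 * #(inNbrs S A b) + Fintype.card V) := by
        simp only [sum_add_distrib, ← mul_sum, sum_card_inter_eq_sum_card_inNbrs]

lemma exists_double_edge {A : Finset V} (hA : 2 * Fintype.card V < 3 * #A) :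
    ∃ a ∈ A, ∃ b ∈ A, a ∈ S b ∧ b ∈ S a ∧ Fintype.card V < 3 * #(inNbrs S A b) := by
  obtain ⟨b, hbA, hb⟩ := exists_inNbrs_large hdeg (card_pos.1 (by omega : 0 < #A))
  obtain ⟨a, haA, hab, hba⟩ := exists_double_of_inNbrs hdeg (A := A) (b := b) (by omega)
  exact ⟨a, haA, b, hbA, hab, hba, by omega⟩

variable (hS : ∀ v, v ∉ S v)
include hS

open Classical in
/-- Some `a ∈ S x` forms a double edge with `b`, and every in-neighbour `z` of `b` that is an
out-neighbour of `a` can replace `x` in the out-triangle `{b, a, x}`. -/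
lemma card_not_linked_lt {b x : V} (hb : 2 * Fintype.card V < 3 * #(inNbrs S univ b))
    (hx : b ∈ S x) :
    3 * #{z ∈ inNbrs S univ b | ¬ Linked {T | OutTriangle S T} z x} < Fintype.card V := by
  have h_inter : inNbrs S univ b ∩ S x = inNbrs S (S x) b := by
    ext; simp [mem_inNbrs, and_comm]
  have h_lt := three_mul_card_lt_card_inter_add hdeg (inNbrs S univ b) x
  rw [h_inter] at h_lt
  obtain ⟨a, hax, hab, hba⟩ := exists_double_of_inNbrs hdeg (A := S x) (b := b) (by omega)
  have hdisj : Disjoint {z ∈ inNbrs S univ b | ¬ Linked {T | OutTriangle S T} z x} (S a) := by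
    refine disjoint_left.2 fun z hz hza => ?_
    rw [mem_filter, mem_inNbrs] at hz
    have hz_tri := OutTriangle.of_double hS hba hab hz.1.2 (Or.inr hza)
    have hx_tri := OutTriangle.of_double hS hba hab hx (Or.inl hax)
    exact hz.2 (.of_triples hz_tri hx_tri hz_tri.1 hx_tri.1 (.refl _ _) (.refl _ _))
  have h_le := card_add_card_le_of_disjoint (subset_univ _) (subset_univ _) hdisj
  have ha := hdeg a
  rw [card_univ] at h_le
  omega

lemma linked_of_large_inNbrs {b x y : V} (hb : 2 * Fintype.card V < 3 * #(inNbrs S univ b))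
    (hx : b ∈ S x) (hy : b ∈ S y) : Linked {T | OutTriangle S T} x y := by
  classical
  have hx_lt := card_not_linked_lt hdeg hS hb hx
  have hy_lt := card_not_linked_lt hdeg hS hb hy
  obtain ⟨z, hzb, hz⟩ := exists_mem_notMem_of_card_lt_card (s :=
    {z ∈ inNbrs S univ b | ¬ Linked {T | OutTriangle S T} z x} ∪
      {z ∈ inNbrs S univ b | ¬ Linked {T | OutTriangle S T} z y}) (t := inNbrs S univ b)
    ((card_union_le _ _).trans_lt (by omega))
  simp only [mem_union, mem_filter, hzb, true_and, not_or, not_not] at hz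
  exact hz.1.symm.trans hz.2

end LargeOutDegree

/-- `α` counts the vertices of large in-degree in an out-neighbourhood of size `a` from outside;
`low`, `hit` and `unhit` count the three classes of `TriangleClosed.degree_balance`. -/
lemma false_of_closed_part {n w a α low hit unhit : ℤ} (hwn : 2 * n < 3 * w) (hw : w < n)
    (ha : 3 * w < 3 * a + n) (hα : 6 * α * (n - w) ≤ a * (2 * n - 3 * a))
    (h_unhit : unhit + a ≤ w) (h_low : a - α ≤ low) (h_sum : low + hit + unhit = w)
    (h_hit : 0 ≤ hit)
    (h_balance : (3 * w - 2 * n) * low + 3 * (n - w) * hit ≤ (3 * w - 2 * n) * unhit) :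
    False := by
  have hα_le : 6 * α ≤ 3 * w - n := by
    have : a * (2 * n - 3 * a) ≤ (3 * w - n) * (n - w) := by nlinarith
    nlinarith
  have h_unhit_sub_lt : 6 * (unhit - low) < 3 * (n - w) := by linarith
  have h_low_le : low ≤ unhit :=
    le_of_mul_le_mul_left
      ((le_add_of_nonneg_right (mul_nonneg (by linarith) h_hit)).trans h_balance)
      (by linarith : 0 < 3 * w - 2 * n)
  have h_hit_lt : 6 * hit < 3 * w - 2 * n := by
    have h_diff := mul_lt_mul_of_pos_left h_unhit_sub_lt (by linarith : 0 < 3 * w - 2 * n)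
    exact lt_of_mul_lt_mul_left (by linarith) (by linarith : 0 ≤ n - w)
  linarith

namespace TriangleClosed

variable {W : Finset V} (hW : TriangleClosed S W) (hS : ∀ v, v ∉ S v)
include hW hS

variable (hdeg : ∀ v, 2 * Fintype.card V < 3 * #(S v))
include hdeg

lemma outNbrs_subset {b : V} (hb : b ∈ W) (hb_in : Fintype.card V ≤ 3 * #(inNbrs S W b)) :
    S b ⊆ W := by
  intro y hy
  by_contra hyW
  have hdisj : Disjoint (inNbrs S W b) (W ∩ S y) := by
    refine disjoint_left.2 fun c hc hc' => ?_
    rw [mem_inNbrs] at hc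
    exact hW c hc.1 b hb y hyW (OutTriangle.of_cycle hS hc.2 hy (mem_inter.1 hc').2)
  have h_le := card_add_card_le_of_disjoint (inNbrs_subset S W b) inter_subset_left hdisj
  have h_lt := three_mul_card_lt_card_inter_add hdeg W y
  omega

lemma card_inNbrs_lt {b y : V} (hb : b ∈ W) (hb_in : Fintype.card V ≤ 3 * #(inNbrs S W b))
    (hy : y ∉ W) (hyb : b ∈ S y) : 3 * #(inNbrs S W b) + Fintype.card V < 3 * #W := by
  have hsub := hW.outNbrs_subset hS hdeg hb hb_in
  have hdisj : Disjoint (inNbrs S W b ∩ S b) (W ∩ S y) := by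
    refine disjoint_left.2 fun c hc hc' => ?_
    rw [mem_inter, mem_inNbrs] at hc
    exact hW.notMem_of_double hS hb hc.1.1 hy hyb hc.2 hc.1.2 (mem_inter.1 hc').2
  have h_inter := card_add_card_le_card_inter_add (inNbrs_subset S W b) hsub
  have h_le := card_add_card_le_of_disjoint
    (inter_subset_left.trans (inNbrs_subset S W b)) inter_subset_left hdisj
  have h_lt := three_mul_card_lt_card_inter_add hdeg W y
  have h_b := hdeg b
  omega

/-- With `α` the number of vertices of `A = W ∩ S x` of large in-degree, this bounds `α`, since
`W` contains no double edge inside `A`. -/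
lemma six_mul_card_le {x : V} (hx : x ∉ W) :
    6 * (#{b ∈ W ∩ S x | Fintype.card V ≤ 3 * #(inNbrs S W b)} : ℤ) * (Fintype.card V - #W) ≤
      #(W ∩ S x) * (2 * Fintype.card V - 3 * #(W ∩ S x)) := by
  set A := W ∩ S x
  set n := Fintype.card V
  have h_no_double : 2 * ∑ v ∈ A, (#(A ∩ S v) : ℤ) ≤ #A ^ 2 := by
    exact_mod_cast two_mul_sum_card_inter_le_sq fun a ha b hb hab hba =>
      hW.notMem_of_double hS (mem_inter.1 hb).1 (mem_inter.1 ha).1 hx (mem_inter.1 hb).2 hab hba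
        (mem_inter.1 ha).2
  have h_out : ∀ v ∈ A, (3 * #A - n + if n ≤ 3 * #(inNbrs S W v) then 3 * (n - #W : ℤ) else 0) ≤
      3 * #(A ∩ S v) := by
    intro v hv
    have h_inter : A ∩ (W ∩ S v) = A ∩ S v := by
      rw [← inter_assoc, inter_eq_left.2 (inter_subset_left : A ⊆ W)]
    have h_A := card_add_card_le_card_inter_add (A := A) (B := W ∩ S v) inter_subset_left
      inter_subset_left
    rw [h_inter] at h_A
    split_ifs with h_high
    · rw [inter_eq_right.2 (hW.outNbrs_subset hS hdeg (mem_inter.1 hv).1 h_high)] at h_A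
      have := hdeg v
      omega
    · have := three_mul_card_lt_card_inter_add hdeg W v
      omega
  have h_sum := sum_le_sum h_out
  rw [← mul_sum, sum_add_distrib, ← sum_filter, sum_const, sum_const, nsmul_eq_mul,
    nsmul_eq_mul] at h_sum
  linarith

/-- The sum over `W` of out-degree minus in-degree, both taken inside `W`, vanishes. The excess is
at least `|W| - 2n/3` at a vertex of in-degree below `n/3`, at least `n - |W|` at one of larger
in-degree that has an in-neighbour outside `W`, and at least `2n/3 - |W|` elsewhere. -/
lemma degree_balance :
    (3 * #W - 2 * Fintype.card V : ℤ) * #{b ∈ W | 3 * #(inNbrs S W b) < Fintype.card V} +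
      3 * (Fintype.card V - #W) *
        #{b ∈ W | ¬ 3 * #(inNbrs S W b) < Fintype.card V ∧ ∃ y ∉ W, b ∈ S y} ≤
    (3 * #W - 2 * Fintype.card V) *
      #{b ∈ W | ¬ 3 * #(inNbrs S W b) < Fintype.card V ∧ ¬ ∃ y ∉ W, b ∈ S y} := by
  classical
  set n := Fintype.card V
  have h_excess : ∀ b ∈ W, (if 3 * #(inNbrs S W b) < n then 3 * #W - 2 * n else
      if ∃ y ∉ W, b ∈ S y then 3 * (n - #W) else -(3 * #W - 2 * n) : ℤ) ≤
      3 * (#(W ∩ S b) - #(inNbrs S W b)) := by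
    intro b hb
    split_ifs with h_low h_hit
    · have := three_mul_card_lt_card_inter_add hdeg W b
      omega
    all_goals
      have h_b := hdeg b
      have h_in := card_le_card (inNbrs_subset S W b)
      rw [inter_eq_right.2 (hW.outNbrs_subset hS hdeg hb (not_lt.1 h_low))]
    · obtain ⟨y, hy, hyb⟩ := h_hit
      have := hW.card_inNbrs_lt hS hdeg hb (not_lt.1 h_low) hy hyb
      omega
    · omega
  have h_zero : ∑ b ∈ W, (#(W ∩ S b) - #(inNbrs S W b) : ℤ) = 0 := by
    rw [sum_sub_distrib, sub_eq_zero]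
    exact_mod_cast sum_card_inter_eq_sum_card_inNbrs S W
  have h_sum := sum_le_sum h_excess
  simp only [← mul_sum, h_zero, sum_ite, filter_filter, sum_const, nsmul_eq_mul] at h_sum
  linarith

lemma eq_univ (hW_card : 2 * Fintype.card V < 3 * #W) : W = univ := by
  classical
  by_contra hne
  obtain ⟨x, hx⟩ : ∃ x, x ∉ W := by simpa [eq_univ_iff_forall] using hne
  have h_split := card_filter_add_card_filter_not (s := W)
    (fun b => 3 * #(inNbrs S W b) < Fintype.card V)
  have h_split_high := card_filter_add_card_filter_not
    (s := {b ∈ W | ¬ 3 * #(inNbrs S W b) < Fintype.card V}) (fun b => ∃ y ∉ W, b ∈ S y)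
  have h_split_A := card_filter_add_card_filter_not (s := W ∩ S x)
    (fun b => Fintype.card V ≤ 3 * #(inNbrs S W b))
  simp only [filter_filter, not_le] at h_split_high h_split_A
  have h_low : #{b ∈ W ∩ S x | 3 * #(inNbrs S W b) < Fintype.card V} ≤
      #{b ∈ W | 3 * #(inNbrs S W b) < Fintype.card V} :=
    card_le_card (filter_subset_filter _ inter_subset_left)
  have h_unhit : #{b ∈ W | ¬ 3 * #(inNbrs S W b) < Fintype.card V ∧ ¬ ∃ y ∉ W, b ∈ S y} +
      #(W ∩ S x) ≤ #W := by
    refine card_add_card_le_of_disjoint (filter_subset _ _) inter_subset_left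
      (disjoint_left.2 fun b hb hbx => ?_)
    exact (mem_filter.1 hb).2.2 ⟨x, hx, (mem_inter.1 hbx).2⟩
  have h_out := three_mul_card_lt_card_inter_add hdeg W x
  have h_lt : #W < Fintype.card V := card_lt_univ_of_notMem hx
  exact false_of_closed_part (by exact_mod_cast hW_card) (by exact_mod_cast h_lt)
    (by exact_mod_cast h_out) (hW.six_mul_card_le hS hdeg hx) (by exact_mod_cast h_unhit)
    (by omega) (by omega) (by positivity) (hW.degree_balance hS hdeg)

end TriangleClosed

theorem linked_of_outDegree (hS : ∀ v, v ∉ S v) (hdeg : ∀ v, 2 * Fintype.card V < 3 * #(S v))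
    (x y : V) : Linked {T | OutTriangle S T} x y := by
  classical
  obtain ⟨b, -, hb⟩ := exists_inNbrs_large hdeg (A := univ) ⟨x, mem_univ x⟩
  rw [card_univ] at hb
  obtain ⟨z, hz⟩ : (inNbrs S univ b).Nonempty := card_pos.1 (by omega)
  set W : Finset V := {v | Linked {T | OutTriangle S T} v z}
  have h_linked {p q} (hp : p ∈ W) (hq : q ∈ W) : Linked {T | OutTriangle S T} p q :=
    (mem_filter_univ _).1 hp |>.trans ((mem_filter_univ _).1 hq).symm
  have hW_card : 2 * Fintype.card V < 3 * #W := by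
    have h_sub : inNbrs S univ b ⊆ W := fun v hv => (mem_filter_univ _).2 <|
      linked_of_large_inNbrs hdeg hS (by omega) (mem_inNbrs.1 hv).2 (mem_inNbrs.1 hz).2
    have := card_le_card h_sub
    omega
  obtain ⟨a, ha, d, hd, had, hda, hd_in⟩ := exists_double_edge hdeg hW_card
  obtain ⟨e, he⟩ : (inNbrs S W d ∩ S a).Nonempty := by
    have := three_mul_card_lt_card_inter_add hdeg (inNbrs S W d) a
    exact card_pos.1 (by omega)
  rw [mem_inter, mem_inNbrs] at he
  have h_tri : OutTriangle S {a, d, e} := .of_double hS hda had he.1.2 (Or.inr he.2)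
  have h_closed : TriangleClosed S W := fun p hp q hq v hv h_tri' => by
    have h_link : Linked {T | OutTriangle S T} v e :=
      .of_triples h_tri' h_tri h_tri'.1 h_tri.1 (h_linked hp ha) (h_linked hq hd)
    exact hv ((mem_filter_univ _).2 (h_link.trans ((mem_filter_univ e).1 he.1.1)))
  have h_univ := h_closed.eq_univ hS hdeg hW_card
  exact h_linked (h_univ ▸ mem_univ x) (h_univ ▸ mem_univ y)

end Digraph

section Density

variable {α β γ V ι : Type*} [Fintype α] [Fintype β] [Fintype γ] [Fintype V]

lemma dens_filter_eq_expect (e : α ≃ β × γ) (P : α → Prop) [DecidablePred P] :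
    (dens {a | P a} : ℝ) = 𝔼 b, (dens {g | P (e.symm (b, g))} : ℝ) := by
  simp only [← expect_indicator_one, Set.indicator_apply, coe_filter, mem_univ, true_and,
    Set.mem_ofPred_eq]
  rw [← expect_product', univ_product_univ]
  exact Fintype.expect_equiv e _ _ fun a => by simp

lemma dens_filter_mono {P Q : α → Prop} [DecidablePred P] [DecidablePred Q] (h : ∀ a, P a → Q a) :
    (dens {a | P a} : ℝ) ≤ dens {a | Q a} := by
  exact_mod_cast dens_le_dens (monotone_filter_right univ fun a _ => h a)

lemma dens_filter_or_le (P Q : α → Prop) [DecidablePred P] [DecidablePred Q] :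
    (dens {a | P a ∨ Q a} : ℝ) ≤ dens {a | P a} + dens {a | Q a} := by
  classical
  rw [filter_or]
  exact_mod_cast dens_union_le _ _

lemma dens_filter_exists_le [Fintype ι] (P : ι → α → Prop) [∀ i, DecidablePred (P i)]
    [DecidablePred fun a => ∃ i, P i a] :
    (dens {a | ∃ i, P i a} : ℝ) ≤ ∑ i, (dens {a | P i a} : ℝ) := by
  classical
  have h_eq : ({a | ∃ i, P i a} : Finset α) = univ.biUnion fun i => {a | P i a} := by ext; simp
  rw [h_eq]
  exact_mod_cast dens_biUnion_le

lemma dens_filter_exists_le_card_mul [Fintype ι] {P : ι → α → Prop} [∀ i, DecidablePred (P i)]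
    [DecidablePred fun a => ∃ i, P i a] {δ : ℝ} (h : ∀ i, (dens {a | P i a} : ℝ) ≤ δ) :
    (dens {a | ∃ i, P i a} : ℝ) ≤ Fintype.card ι * δ := by
  rw [← nsmul_eq_mul]
  exact (dens_filter_exists_le P).trans (sum_le_card_nsmul univ _ δ fun i _ => h i)

lemma dens_filter_le_of_update [Fintype ι] [DecidableEq ι] [Nonempty V] {P : (ι → V) → Prop}
    [DecidablePred P] (i : ι) {δ : ℝ}
    (h : ∀ v, (dens {a | P (Function.update v i a)} : ℝ) ≤ δ) : (dens {v | P v} : ℝ) ≤ δ := by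
  rw [dens_filter_eq_expect ((Equiv.funSplitAt i V).trans (Equiv.prodComm _ _))]
  refine expect_le univ_nonempty fun w _ => ?_
  obtain ⟨v, rfl⟩ : ∃ v : ι → V, (fun j : {j // j ≠ i} => v j) = w :=
    ⟨(Equiv.funSplitAt i V).symm (Classical.arbitrary V, w),
      congr_arg Prod.snd ((Equiv.funSplitAt i V).apply_symm_apply (Classical.arbitrary V, w))⟩
  refine (dens_filter_mono fun a ha => ?_).trans (h v)
  convert ha using 1
  ext j
  by_cases hj : j = i
  · subst hj; simp
  · simp [hj]

lemma dens_filter_comp {J : Type*} [Fintype ι] [DecidableEq ι] [Fintype J] [DecidableEq J]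
    [Nonempty V] {f : J → ι} (hf : Function.Injective f) (P : (J → V) → Prop) [DecidablePred P] :
    (dens {w : ι → V | P (w ∘ f)} : ℝ) = dens {v | P v} := by
  classical
  let e : (ι → V) ≃ ({i // i ∉ Set.range f} → V) × (J → V) :=
    (Equiv.piEquivPiSubtypeProd (· ∈ Set.range f) _).trans <| (Equiv.prodComm _ _).trans <|
      (Equiv.refl _).prodCongr ((Equiv.ofInjective f hf).arrowCongr (Equiv.refl V)).symm
  have he : ∀ b v, e.symm (b, v) ∘ f = v := fun b v =>
    congr_arg Prod.snd (e.apply_symm_apply (b, v))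
  rw [dens_filter_eq_expect e]
  simp only [he, Fintype.expect_const]

lemma dens_piFinset {J : Type*} [Fintype J] [DecidableEq J] (C : Finset V) :
    (dens (Fintype.piFinset fun _ : J => C) : ℝ) = (dens C : ℝ) ^ Fintype.card J := by
  simp [nnratCast_dens, div_pow]

lemma expect_pow_le_pow_expect [Nonempty α] {f : α → ℝ} (hf : ∀ a, 0 ≤ f a) (t : ℕ) :
    (𝔼 a, f a) ^ t ≤ 𝔼 a, f a ^ t := by
  simp only [Fintype.expect_eq_sum_div_card, div_eq_inv_mul, mul_sum]
  exact Real.pow_arith_mean_le_arith_mean_pow univ _ f (fun _ _ => by positivity) (by simp)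
    (fun a _ => hf a) t

end Density

section BlowUp

variable {V : Type*} [Fintype V] [DecidableEq V] {k : ℕ}

/-- The blow-up of a family `Q` of `k`-tuples: the sequences of `k` blocks of `t` entries all of
whose transversals lie in `Q`. -/
def blowUp (Q : Finset (Fin k → V)) (t : ℕ) : Finset (Fin k → Fin t → V) :=
  {w | ∀ s : Fin k → Fin t, (fun i => w i (s i)) ∈ Q}

lemma mem_blowUp {Q : Finset (Fin k → V)} {t : ℕ} {w : Fin k → Fin t → V} :
    w ∈ blowUp Q t ↔ ∀ s : Fin k → Fin t, (fun i => w i (s i)) ∈ Q := mem_filter_univ w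

lemma cons_mem_blowUp {Q : Finset (Fin (k + 1) → V)} {t : ℕ} {u : Fin t → V}
    {w : Fin k → Fin t → V} :
    (Fin.cons u w : Fin (k + 1) → Fin t → V) ∈ blowUp Q t ↔
      w ∈ blowUp {v | ∀ j, (Fin.cons (u j) v : Fin (k + 1) → V) ∈ Q} t := by
  have h_cons (j : Fin t) (s : Fin k → Fin t) :
      (fun i => (Fin.cons u w : Fin (k + 1) → Fin t → V) i
        ((Fin.cons j s : Fin (k + 1) → Fin t) i)) = Fin.cons (u j) fun i => w i (s i) := by
    funext i
    cases i using Fin.cases <;> simp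
  simp only [mem_blowUp, Fin.forall_fin_succ_pi, h_cons, mem_filter_univ]
  exact forall_comm

lemma expect_dens_pow_eq_expect_dens (Q : Finset (Fin (k + 1) → V)) (t : ℕ) :
    𝔼 v : Fin k → V, (dens {a | (Fin.cons a v : Fin (k + 1) → V) ∈ Q} : ℝ) ^ t =
      𝔼 u : Fin t → V, (dens {v | ∀ j, (Fin.cons (u j) v : Fin (k + 1) → V) ∈ Q} : ℝ) := by
  let P (p : (Fin t → V) × (Fin k → V)) : Prop :=
    ∀ j, (Fin.cons (p.1 j) p.2 : Fin (k + 1) → V) ∈ Q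
  have h_fiber (v : Fin k → V) :
      (dens {a | (Fin.cons a v : Fin (k + 1) → V) ∈ Q} : ℝ) ^ t = dens {u | P (u, v)} := by
    have h_pi : ({u | P (u, v)} : Finset (Fin t → V)) =
        Fintype.piFinset fun _ => {a | (Fin.cons a v : Fin (k + 1) → V) ∈ Q} := by
      ext u
      simp [P]
    rw [h_pi, dens_piFinset, Fintype.card_fin]
  rw [expect_congr rfl fun v _ => h_fiber v]
  exact (dens_filter_eq_expect (Equiv.prodComm _ _) P).symm.trans
    (dens_filter_eq_expect (Equiv.refl _) P)

/-- Conditioning on the last `k` entries gives the first factor of the exponent, conditioning on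
the first block gives the rest; both use the convexity of powers. -/
lemma dens_pow_le_dens_blowUp [Nonempty V] (t : ℕ) (Q : Finset (Fin k → V)) :
    (dens Q : ℝ) ^ (t ^ k) ≤ dens (blowUp Q t) := by
  induction k with
  | zero =>
    obtain rfl | hQ := Q.eq_empty_or_nonempty
    · simpa using NNRat.cast_nonneg _
    · have h_univ : blowUp Q t = univ := by
        rw [hQ.eq_univ]
        exact eq_univ_iff_forall.2 fun w => mem_blowUp.2 fun s => mem_univ _
      rw [h_univ, hQ.eq_univ]
      simp
  | succ k ih =>
    let p (v : Fin k → V) : ℝ := dens {a | (Fin.cons a v : Fin (k + 1) → V) ∈ Q}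
    let Q' (u : Fin t → V) : Finset (Fin k → V) :=
      {v | ∀ j, (Fin.cons (u j) v : Fin (k + 1) → V) ∈ Q}
    have h_dens : (dens Q : ℝ) = 𝔼 v, p v := by
      conv_lhs => rw [← filter_univ_mem Q]
      exact dens_filter_eq_expect
        ((Fin.consEquiv fun _ => V).symm.trans (Equiv.prodComm _ _)) (· ∈ Q)
    have h_blowUp : (dens (blowUp Q t) : ℝ) = 𝔼 u, (dens (blowUp (Q' u) t) : ℝ) := by
      simpa [Fin.consEquiv, cons_mem_blowUp] using
        dens_filter_eq_expect (Fin.consEquiv fun _ => Fin t → V).symm (· ∈ blowUp Q t)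
    calc (dens Q : ℝ) ^ (t ^ (k + 1)) = ((𝔼 v, p v) ^ t) ^ (t ^ k) := by
          rw [h_dens, ← pow_mul, pow_succ']
      _ ≤ (𝔼 v, p v ^ t) ^ (t ^ k) :=
          pow_le_pow_left₀ (pow_nonneg (h_dens ▸ by positivity) t)
            (expect_pow_le_pow_expect (fun _ => by positivity) t) _
      _ = (𝔼 u, (dens (Q' u) : ℝ)) ^ (t ^ k) := by
          rw [← expect_dens_pow_eq_expect_dens]
      _ ≤ 𝔼 u, (dens (Q' u) : ℝ) ^ (t ^ k) := expect_pow_le_pow_expect (fun _ => by positivity) _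
      _ ≤ 𝔼 u, (dens (blowUp (Q' u) t) : ℝ) := expect_le_expect fun u _ => ih (Q' u)
      _ = dens (blowUp Q t) := h_blowUp.symm

end BlowUp

section Sampling

variable {J V : Type*} [Fintype J] [DecidableEq J] [Fintype V]

lemma dens_filter_le_expect {α : Type*} [Fintype α] {P : α → Prop} [DecidablePred P] {f : α → ℝ}
    (hf : ∀ a, 0 ≤ f a) (hP : ∀ a, P a → 1 ≤ f a) : (dens {a | P a} : ℝ) ≤ 𝔼 a, f a := by
  rw [← expect_indicator_one]
  refine expect_le_expect fun a _ => ?_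
  by_cases ha : P a <;> simp [ha, hf a, hP a]

lemma expect_prod_eq_pow (g : V → ℝ) :
    𝔼 v : J → V, ∏ j, g (v j) = (𝔼 a, g a) ^ Fintype.card J := by
  have h_sum := prod_univ_sum (fun _ : J => (univ : Finset V)) (fun _ a => g a)
  rw [Fintype.piFinset_univ, prod_const, card_univ] at h_sum
  simp [Fintype.expect_eq_sum_div_card, ← h_sum, div_pow]

variable [DecidableEq V]

lemma expect_exp_neg_mem_le [Nonempty V] {T : Finset V} {q t : ℝ} (hq : q ≤ dens T)
    (ht0 : 0 ≤ t) (ht1 : t ≤ 1) :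
    𝔼 a, (if a ∈ T then Real.exp (-t) else 1) ≤ Real.exp (-(t * q) + t ^ 2) := by
  have h_exp : t - t ^ 2 ≤ 1 - Real.exp (-t) := by
    have := (abs_le.1 (Real.abs_exp_sub_one_sub_id_le (x := -t) (by simpa [abs_of_nonneg ht0]))).2
    linarith [neg_sq t]
  have h_dens : (dens T : ℝ) ≤ 1 := by exact_mod_cast dens_le_one
  have h_expect : 𝔼 a, (if a ∈ T then Real.exp (-t) else 1) =
      1 - dens T * (1 - Real.exp (-t)) := by
    have h_ite (a : V) : (if a ∈ T then Real.exp (-t) else 1) =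
        1 - Set.indicator T 1 a * (1 - Real.exp (-t)) := by
      by_cases ha : a ∈ T <;> simp [ha]
    simp only [h_ite, expect_sub_distrib, ← expect_mul, expect_indicator_one, Fintype.expect_const]
  calc 𝔼 a, (if a ∈ T then Real.exp (-t) else 1)
      = 1 - dens T * (1 - Real.exp (-t)) := h_expect
    _ ≤ 1 - dens T * (t - t ^ 2) := by gcongr
    _ ≤ 1 - t * q + t ^ 2 := by nlinarith
    _ ≤ Real.exp (-(t * q) + t ^ 2) := by linarith [Real.add_one_le_exp (-(t * q) + t ^ 2)]

/-- Chernoff's bound, from Markov's inequality for `exp (s / 2 * ((q - s) |J| - #hits))`. -/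
lemma dens_card_filter_mem_le [Nonempty V] {T : Finset V} {q s : ℝ} (hq : q ≤ dens T)
    (hs0 : 0 ≤ s) (hs1 : s ≤ 1) :
    (dens {v : J → V | (#{j | v j ∈ T} : ℝ) ≤ (q - s) * Fintype.card J} : ℝ) ≤
      Real.exp (-(s ^ 2 * Fintype.card J / 4)) := by
  let m : ℝ := Fintype.card J
  let g (a : V) : ℝ := if a ∈ T then Real.exp (-(s / 2)) else 1
  have hg (v : J → V) : ∏ j, g (v j) = Real.exp (-(s / 2 * #{j | v j ∈ T})) := by
    simp only [g, prod_ite, prod_const, ← Real.exp_nat_mul]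
    ring_nf
  calc (dens {v : J → V | (#{j | v j ∈ T} : ℝ) ≤ (q - s) * m} : ℝ)
      ≤ 𝔼 v : J → V, Real.exp (s / 2 * ((q - s) * m)) * ∏ j, g (v j) := by
        refine dens_filter_le_expect (fun v => ?_) fun v hv => ?_ <;> rw [hg, ← Real.exp_add]
        · positivity
        · exact Real.one_le_exp (by nlinarith)
    _ = Real.exp (s / 2 * ((q - s) * m)) * (𝔼 a, g a) ^ Fintype.card J := by
        rw [← mul_expect, expect_prod_eq_pow]
    _ ≤ Real.exp (s / 2 * ((q - s) * m)) *
          Real.exp (-(s / 2 * q) + (s / 2) ^ 2) ^ Fintype.card J := by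
        have h0 : 0 ≤ 𝔼 a, g a := expect_nonneg fun a _ => by simp only [g]; positivity
        gcongr
        exact expect_exp_neg_mem_le hq (by linarith) (by linarith)
    _ = Real.exp (-(s ^ 2 * m / 4)) := by
        rw [← Real.exp_nat_mul, ← Real.exp_add]
        simp only [m]
        ring_nf

lemma dens_card_filter_mem_apply_le [Nonempty V] (i : J) {S : V → Finset V} {q s : ℝ}
    (hq : ∀ a, q ≤ dens (S a)) (hs0 : 0 ≤ s) (hs1 : s ≤ 1) :
    (dens {v : J → V | (#{j | v j ∈ S (v i)} : ℝ) ≤ (q - s) * (Fintype.card J - 1)} : ℝ) ≤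
      Real.exp (-(s ^ 2 * (Fintype.card J - 1) / 4)) := by
  have h_card : (Fintype.card {j // j ≠ i} : ℝ) = Fintype.card J - 1 := by
    rw [Fintype.card_subtype_compl, Fintype.card_subtype_eq,
      Nat.cast_pred (Fintype.card_pos_iff.2 ⟨i⟩)]
  rw [← h_card, dens_filter_eq_expect (Equiv.funSplitAt i V)]
  refine expect_le univ_nonempty fun a _ => le_trans (dens_filter_mono fun w hw => ?_)
    (dens_card_filter_mem_le (J := {j // j ≠ i}) (hq a) hs0 hs1)
  refine le_trans ?_ hw
  have h_map : ({j | w j ∈ S a} : Finset {j // j ≠ i}).map (Function.Embedding.subtype _) ⊆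
      ({j | (Equiv.funSplitAt i V).symm (a, w) j ∈
        S ((Equiv.funSplitAt i V).symm (a, w) i)} : Finset J) := by
    intro j hj
    obtain ⟨k, hk, rfl⟩ := mem_map.1 hj
    simpa [k.2] using hk
  simpa using card_le_card h_map

lemma dens_filter_apply_mem (i : J) (Z : Finset V) [Nonempty V] :
    (dens {v : J → V | v i ∈ Z} : ℝ) ≤ dens Z :=
  dens_filter_le_of_update i fun v => by simp

lemma dens_filter_apply_eq_apply_le {i j : J} (h : i ≠ j) [Nonempty V] :
    (dens {v : J → V | v i = v j} : ℝ) ≤ 1 / Fintype.card V :=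
  dens_filter_le_of_update i fun v => by simp [Function.update_of_ne h.symm, filter_eq']

end Sampling

section Tiling

variable {V K A ι J : Type*} {G : SimpleGraph V} {c : G.EdgeLabeling K} {r : ℕ}

lemma HasPerfectRainbowTiling.empty : HasPerfectRainbowTiling c r ∅ :=
  ⟨∅, by simp, by simp, by simp⟩

lemma IsRainbowClique.hasPerfectRainbowTiling {T : Finset V} (hT : IsRainbowClique c r T) :
    HasPerfectRainbowTiling c r T :=
  ⟨{T}, by simpa using hT, by simp, by simp⟩

variable [DecidableEq V]

lemma HasPerfectRainbowTiling.union {S T : Finset V} (hS : HasPerfectRainbowTiling c r S)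
    (hT : HasPerfectRainbowTiling c r T) (hST : Disjoint S T) :
    HasPerfectRainbowTiling c r (S ∪ T) := by
  obtain ⟨P, hP_clique, hP_disj, hP_cover⟩ := hS
  obtain ⟨Q, hQ_clique, hQ_disj, hQ_cover⟩ := hT
  have h_cross : ∀ B ∈ P, ∀ C ∈ Q, Disjoint B C := fun B hB C hC =>
    hST.mono (fun v hv => (hP_cover v).2 ⟨B, hB, hv⟩) fun v hv => (hQ_cover v).2 ⟨C, hC, hv⟩
  refine ⟨P ∪ Q, fun B hB => (mem_union.1 hB).elim (hP_clique B) (hQ_clique B), ?_, fun v => ?_⟩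
  · intro B hB C hC hBC
    rcases mem_union.1 hB with hB | hB <;> rcases mem_union.1 hC with hC | hC
    exacts [hP_disj B hB C hC hBC, h_cross B hB C hC, (h_cross C hC B hB).symm,
      hQ_disj B hB C hC hBC]
  · simp only [mem_union, hP_cover, hQ_cover, or_and_right, exists_or]

lemma HasPerfectRainbowTiling.biUnion {F : Finset A} {T : A → Finset V}
    (hdisj : (F : Set A).PairwiseDisjoint T) (hT : ∀ a ∈ F, HasPerfectRainbowTiling c r (T a)) :
    HasPerfectRainbowTiling c r (F.biUnion T) := by
  classical
  induction F using Finset.induction_on with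
  | empty => exact .empty
  | insert a F ha ih =>
    rw [coe_insert, Set.pairwiseDisjoint_insert_of_notMem (mem_coe.not.2 ha)] at hdisj
    rw [biUnion_insert]
    exact (hT a (mem_insert_self a F)).union
      (ih hdisj.1 fun b hb => hT b (mem_insert_of_mem hb))
      ((disjoint_biUnion_right _ _ _).2 hdisj.2)

lemma exists_bijOn_fibers [Fintype A] [Fintype J] [DecidableEq ι] (q : A → Finset ι) (κ : J → ι)
    (h : ∀ i, #{α | κ α = i} = #{a | i ∈ q a}) :
    ∃ f : J → A, ∀ a, Set.BijOn κ {α | f α = a} (q a) := by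
  have e (i : ι) : {α // κ α = i} ≃ {a // i ∈ q a} :=
    Fintype.equivOfCardEq (by simpa only [Fintype.card_subtype] using h i)
  let f (α : J) : A := e (κ α) ⟨α, rfl⟩
  have hf {i : ι} {α : J} (h : κ α = i) : f α = e i ⟨α, h⟩ := by
    subst h
    rfl
  refine ⟨f, fun a => ⟨?_, ?_, ?_⟩⟩
  · rintro α rfl
    exact (e (κ α) ⟨α, rfl⟩).2
  · intro α hα β hβ hαβ
    have h_eq : e (κ β) ⟨α, hαβ⟩ = e (κ β) ⟨β, rfl⟩ :=
      Subtype.ext ((hf hαβ).symm.trans (hα.trans hβ.symm))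
    exact congr_arg Subtype.val ((e (κ β)).injective h_eq)
  · intro i hi
    obtain ⟨⟨α, hα⟩, h_eq⟩ := (e i).surjective ⟨a, hi⟩
    exact ⟨α, (hf hα).trans (congr_arg Subtype.val h_eq), hα⟩

lemma hasPerfectRainbowTiling_of_labelling [Fintype A] [Fintype J] [DecidableEq ι]
    {q : A → Finset ι} {κ : J → ι} (hκ : ∀ i, #{α | κ α = i} = #{a | i ∈ q a}) {u : J → V}
    (hu : Function.Injective u) {Z : A → Finset V} (hZ : Pairwise (Function.onFun Disjoint Z))
    (hZu : ∀ a, Disjoint (Z a) (univ.image u))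
    (hclique : ∀ a (B : Finset J), Set.BijOn κ B (q a) → IsRainbowClique c r (B.image u ∪ Z a)) :
    HasPerfectRainbowTiling c r (univ.image u ∪ univ.biUnion Z) := by
  classical
  obtain ⟨f, hf⟩ := exists_bijOn_fibers q κ hκ
  let B (a : A) : Finset J := {α | f α = a}
  have h_cover : univ.image u ∪ univ.biUnion Z = univ.biUnion fun a => (B a).image u ∪ Z a := by
    ext v
    simp [B, exists_or]
  rw [h_cover]
  refine .biUnion (fun a _ b _ hab => ?_) fun a _ =>
    (hclique a (B a) (by simpa [B] using hf a)).hasPerfectRainbowTiling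
  have h_sub (a : A) : (B a).image u ⊆ univ.image u := image_subset_image (subset_univ _)
  have h_image : Disjoint ((B a).image u) ((B b).image u) :=
    (disjoint_image hu).2 (disjoint_filter.2 fun α _ ha hb => hab (ha.symm.trans hb))
  exact disjoint_union_left.2 ⟨disjoint_union_right.2 ⟨h_image, (hZu b).symm.mono_left (h_sub a)⟩,
    disjoint_union_right.2 ⟨(hZu a).mono_right (h_sub b), hZ hab⟩⟩

end Tiling

section Exchange

variable {ι : Type*} [DecidableEq ι] {E : Set (Finset ι)} {r : ℕ}

lemma indicatorVec_apply (e : Finset ι) (i : ι) : indicatorVec e i = if i ∈ e then 1 else 0 := by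
  simp [indicatorVec, Finset.sum_apply, Pi.single_apply]

lemma indicatorVec_sub_card_smul_mem (hlink : ∀ i j, Linked E i j) (e : Finset ι) (i₀ : ι) :
    indicatorVec e - #e • Pi.single i₀ 1 ∈ spanLattice E := by
  rw [indicatorVec, ← sum_const, ← sum_sub_distrib]
  exact Submodule.sum_mem _ fun i _ => hlink i i₀

/-- Modulo the lattice all unit vectors agree, so that membership depends only on the coordinate
sum, and this is a multiple of `r`. -/
lemma sum_indicatorVec_mem [Nonempty ι] (hE : ∀ e ∈ E, #e = r) (hne : E.Nonempty)
    (hlink : ∀ i j, Linked E i j) {d : Fin r → Finset ι} (hd : ∀ k, #(d k) = r - 1) :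
    ∑ k, indicatorVec (d k) ∈ spanLattice E := by
  obtain ⟨e₀, he₀⟩ := hne
  have i₀ : ι := Classical.arbitrary ι
  have h_unit : r • (Pi.single i₀ 1 : ι → ℤ) ∈ spanLattice E := by
    have := (spanLattice E).sub_mem (Submodule.subset_span (Set.mem_image_of_mem _ he₀))
      (indicatorVec_sub_card_smul_mem hlink e₀ i₀)
    rwa [sub_sub_cancel, hE e₀ he₀] at this
  have h_diff : ∑ k, (indicatorVec (d k) - #(d k) • Pi.single i₀ 1) ∈ spanLattice E :=
    Submodule.sum_mem _ fun k _ => indicatorVec_sub_card_smul_mem hlink (d k) i₀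
  convert add_mem h_diff ((spanLattice E).smul_mem ((r - 1 : ℕ) : ℤ) h_unit) using 1
  simp only [hd, sum_sub_distrib, sum_const, card_univ, Fintype.card_fin, natCast_zsmul,
    smul_comm (r - 1) r, sub_add_cancel]

variable [Fintype ι]

/-- The weights `p` and `q` on the members of `E` form an exchange for the sets `d k`: the
multiset `p` covers every index as often as `q` together with one copy of each `d k` does. -/
structure IsExchange {l : ℕ} (E : Set (Finset ι)) (d : Fin l → Finset ι) (p q : Finset ι → ℕ) :
    Prop where
  mem_of_left : ∀ e, p e ≠ 0 → e ∈ E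
  mem_of_right : ∀ e, q e ≠ 0 → e ∈ E
  balance : ∀ i, ∑ e with i ∈ e, p e = ∑ e with i ∈ e, q e + #{k | i ∈ d k}

lemma exists_isExchange_of_mem {l : ℕ} {d : Fin l → Finset ι}
    (h : ∑ k, indicatorVec (d k) ∈ spanLattice E) : ∃ p q, IsExchange E d p q := by
  obtain ⟨a, ha, ha_sum⟩ := (Finsupp.mem_span_image_iff_linearCombination ℤ).1 h
  have h_supp (e : Finset ι) (he : a e ≠ 0) : e ∈ E :=
    (Finsupp.mem_supported ℤ a).1 ha (Finsupp.mem_support_iff.2 he)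
  refine ⟨fun e => (a e).toNat, fun e => (-a e).toNat, fun e he => h_supp e (by grind),
    fun e he => h_supp e (by grind), fun i => ?_⟩
  have h_apply : ∑ e with i ∈ e, a e = #{k | i ∈ d k} := by
    have := congr_fun ha_sum i
    simpa [Finsupp.linearCombination_apply, Finsupp.sum_fintype, Finset.sum_apply,
      indicatorVec_apply, sum_filter] using this
  have h_split (e : Finset ι) : ((a e).toNat : ℤ) = (-a e).toNat + a e := by grind
  zify
  rw [sum_congr rfl fun e _ => h_split e, sum_add_distrib, h_apply]

lemma eventually_exists_isExchange [Nonempty ι] (hE : ∀ e ∈ E, #e = r) (hne : E.Nonempty)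
    (hlink : ∀ i j, Linked E i j) {d : Fin r → Finset ι} (hd : ∀ k, #(d k) = r - 1) :
    ∀ᶠ N in Filter.atTop, ∃ p q, IsExchange E d p q ∧ ∑ e, p e = N := by
  obtain ⟨p, q, hpq⟩ := exists_isExchange_of_mem (sum_indicatorVec_mem hE hne hlink hd)
  obtain ⟨e₀, he₀⟩ := hne
  filter_upwards [Filter.eventually_ge_atTop (∑ e, p e)] with N hN
  let pad : Finset ι → ℕ := Pi.single e₀ (N - ∑ e, p e)
  have h_mem (e : Finset ι) (he : pad e ≠ 0) : e ∈ E := by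
    obtain rfl : e = e₀ := by
      by_contra hne
      exact he (Pi.single_eq_of_ne hne _)
    exact he₀
  refine ⟨p + pad, q + pad, ⟨fun e he => ?_, fun e he => ?_, fun i => ?_⟩, ?_⟩
  · by_cases hp : p e = 0
    exacts [h_mem e (by simpa [hp] using he), hpq.mem_of_left e hp]
  · by_cases hq : q e = 0
    exacts [h_mem e (by simpa [hq] using he), hpq.mem_of_right e hq]
  · simp only [Pi.add_apply, sum_add_distrib, hpq.balance i]
    ring
  · simp only [Pi.add_apply, sum_add_distrib, pad, sum_pi_single', mem_univ, if_true]
    omega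

lemma exists_labelling {m : ℕ} {s : ι → ℕ} (hs : ∑ i, s i = m) :
    ∃ κ : Fin m → ι, ∀ i, #{α | κ α = i} = s i := by
  have e : Fin m ≃ Σ i, Fin (s i) := (Fintype.equivFinOfCardEq (by simp [hs])).symm
  refine ⟨fun α => (e α).1, fun i => ?_⟩
  rw [← Fintype.card_subtype, Fintype.card_congr ((e.subtypeEquiv fun α => Iff.rfl).trans
    (Equiv.sigmaSubtype i)), Fintype.card_fin]

lemma sum_sum_filter_mem {p : Finset ι → ℕ} (hp : ∀ e, p e ≠ 0 → #e = r) :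
    ∑ i, ∑ e with i ∈ e, p e = r * ∑ e, p e := by
  simp only [sum_filter]
  rw [sum_comm, mul_sum]
  refine sum_congr rfl fun e _ => ?_
  by_cases he : p e = 0
  · simp [he]
  · rw [sum_ite_mem, univ_inter, sum_const, hp e he, smul_eq_mul]

end Exchange

section Diagonal

variable {V : Type*} {M t : ℕ}

/-- The tuple picking one entry from each of the blocks of a blow-up that are prescribed by the
labelling `κ`, the `α`-th entry being the `α`-th one of its block. -/
def diagonal (κ : Fin t → Fin M) (w : Fin M → Fin t → V) (α : Fin t) : V := w (κ α) α

lemma dens_filter_diagonal [Fintype V] [Nonempty V] (κ : Fin t → Fin M) (P : (Fin t → V) → Prop)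
    [DecidablePred P] :
    (dens {w : Fin M → Fin t → V | P (diagonal κ w)} : ℝ) = dens {u | P u} := by
  have hf : Function.Injective fun α => (κ α, α) := fun α β h => congr_arg Prod.snd h
  rw [← dens_filter_comp hf, ← dens_map_equiv (Equiv.curry (Fin M) (Fin t) V).symm]
  congr 2
  ext w
  simp only [mem_map_equiv, mem_filter, mem_univ, true_and]
  rfl

end Diagonal

section Absorber

variable {V K : Type*} [DecidableEq V] {G : SimpleGraph V} {c : G.EdgeLabeling K} {r M t : ℕ}

/-- The vertex set `A` absorbs `X`: it is disjoint from `X` and has a perfect rainbow-`K_r`-tiling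
both without and with the vertices of `X`. -/
structure Absorbs (c : G.EdgeLabeling K) (r : ℕ) (X A : Finset V) : Prop where
  disjoint : Disjoint A X
  tiling : HasPerfectRainbowTiling c r A
  tiling_union : HasPerfectRainbowTiling c r (A ∪ X)

/-- The tuple `v` realizes the pattern `(E, d)` at `x`: it maps the members of `E` to rainbow
`r`-cliques, and each `d k` to a set that forms a rainbow `r`-clique together with `x k`. -/
structure Realizes (c : G.EdgeLabeling K) (r : ℕ) {ι : Type*} {l : ℕ} (x : Fin l → V)
    (E : Set (Finset ι)) (d : Fin l → Finset ι) (v : ι → V) : Prop where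
  isRainbowClique : ∀ e ∈ E, IsRainbowClique c r (e.image v)
  isRainbowClique_union : ∀ k, IsRainbowClique c r ((d k).image v ∪ {x k})

lemma hasPerfectRainbowTiling_union_biUnion {A : Type*} {k : ℕ} {S : A → Finset V}
    {F : Finset A} {U : Finset V} (hdisj : (F : Set A).PairwiseDisjoint S)
    (htile : ∀ a ∈ F, HasPerfectRainbowTiling c r (S a)) (hUS : Disjoint U (F.biUnion S))
    (hU : #U = r * k)
    (h_absorb : ∀ X ⊆ U, #X = r → ∃ F' ⊆ F, k ≤ #F' ∧ ∀ a ∈ F', Absorbs c r X (S a)) :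
    HasPerfectRainbowTiling c r (U ∪ F.biUnion S) := by
  classical
  induction k generalizing U F with
  | zero =>
    obtain rfl : U = ∅ := by simpa using hU
    simpa using HasPerfectRainbowTiling.biUnion hdisj htile
  | succ k ih =>
    obtain ⟨X, hXU, hX⟩ := exists_subset_card_eq (s := U) (n := r) (by rw [hU]; nlinarith)
    obtain ⟨F', hF'F, hF', h_absorbs⟩ := h_absorb X hXU hX
    obtain ⟨a, haF'⟩ : F'.Nonempty := card_pos.1 (by lia)
    have haF := hF'F haF'
    have h_rest : HasPerfectRainbowTiling c r ((U \ X) ∪ (F.erase a).biUnion S) := by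
      refine ih (hdisj.subset (coe_subset.2 (erase_subset a F)))
        (fun b hb => htile b (mem_of_mem_erase hb))
        (hUS.mono sdiff_subset (biUnion_subset_biUnion_of_subset_left S (erase_subset a F)))
        (by rw [card_sdiff_of_subset hXU, hU, hX]; lia) fun Y hYU hY => ?_
      obtain ⟨F'', hF'', hk, h⟩ := h_absorb Y (hYU.trans sdiff_subset) hY
      exact ⟨F''.erase a, erase_subset_erase a hF'',
        by have := pred_card_le_card_erase (s := F'') (a := a); lia,
        fun b hb => h b (mem_of_mem_erase hb)⟩
    have h_biUnion : F.biUnion S = S a ∪ (F.erase a).biUnion S := by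
      rw [← biUnion_insert, insert_erase haF]
    have h_disj : Disjoint (S a ∪ X) ((U \ X) ∪ (F.erase a).biUnion S) := by
      have h_erase : Disjoint (S a) ((F.erase a).biUnion S) :=
        (disjoint_biUnion_right _ _ _).2 fun b hb =>
          hdisj haF (mem_of_mem_erase hb) (ne_of_mem_erase hb).symm
      rw [h_biUnion, disjoint_union_right] at hUS
      exact disjoint_union_left.2
        ⟨disjoint_union_right.2 ⟨(hUS.1.mono_left sdiff_subset).symm, h_erase⟩,
          disjoint_union_right.2 ⟨disjoint_sdiff, hUS.2.mono_left hXU⟩⟩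
    have h_union : U ∪ F.biUnion S = (S a ∪ X) ∪ ((U \ X) ∪ (F.erase a).biUnion S) := by
      rw [h_biUnion, union_assoc (S a), ← union_assoc X, union_sdiff_of_subset hXU,
        union_left_comm]
    rw [h_union]
    exact (h_absorbs a haF').tiling_union.union h_rest h_disj

lemma exists_image_eq_image_diagonal [Fintype V] {R : Finset (Fin M → V)} {κ : Fin t → Fin M}
    {w : Fin M → Fin t → V} (hw : w ∈ blowUp R t) (ht : 0 < t) {B : Finset (Fin t)}
    {e : Finset (Fin M)} (hB : Set.BijOn κ B e) :
    ∃ v ∈ R, e.image v = B.image (diagonal κ w) := by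
  have : Nonempty (Fin t) := ⟨⟨0, ht⟩⟩
  let s := Function.invFunOn κ B
  refine ⟨fun i => w i (s i), mem_blowUp.1 hw s, ?_⟩
  have he : e = B.image κ := by
    rw [← coe_inj, coe_image, hB.image_eq]
  rw [he, image_image]
  exact image_congr fun α hα => congr_arg (w (κ α)) (hB.injOn.leftInvOn_invFunOn hα)

lemma card_filter_mem_sumElim {ι : Type*} [Fintype ι] [DecidableEq ι] {l : ℕ} (q : Finset ι → ℕ)
    (d : Fin l → Finset ι) (i : ι) :
    #{a : (Σ e, Fin (q e)) ⊕ Fin l | i ∈ Sum.elim Sigma.fst d a} =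
      ∑ e with i ∈ e, q e + #{k | i ∈ d k} := by
  have h_fiber (e : Finset ι) : ∑ _j : Fin (q e), (if i ∈ e then 1 else 0) =
      if i ∈ e then q e else 0 := by
    split_ifs <;> simp
  rw [card_filter, Fintype.sum_sum_type, Fintype.sum_sigma, sum_filter, card_filter]
  exact congr_arg (· + _) (sum_congr rfl fun e _ => h_fiber e)

variable [Fintype V] {l : ℕ} {x : Fin l → V} {E : Set (Finset (Fin M))}
  {d : Fin l → Finset (Fin M)} {R : Finset (Fin M → V)} {p q : Finset (Fin M) → ℕ}
  {κ : Fin t → Fin M} {w : Fin M → Fin t → V}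

lemma hasPerfectRainbowTiling_diagonal_union (hR : ∀ v ∈ R, Realizes c r x E d v)
    (hx : Function.Injective x) (hq : ∀ e, q e ≠ 0 → e ∈ E)
    (hκ : ∀ i, #{α | κ α = i} = ∑ e with i ∈ e, q e + #{k | i ∈ d k}) (ht : 0 < t)
    (hw : w ∈ blowUp R t) (hinj : Function.Injective (diagonal κ w))
    (hdisj : Disjoint (univ.image (diagonal κ w)) (univ.image x)) :
    HasPerfectRainbowTiling c r (univ.image (diagonal κ w) ∪ univ.image x) := by
  let Z : (Σ e, Fin (q e)) ⊕ Fin l → Finset V := Sum.elim (fun _ => ∅) fun k => {x k}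
  have hZ : univ.biUnion Z = univ.image x := by
    ext v
    simp [Z, eq_comm]
  rw [← hZ] at hdisj ⊢
  refine hasPerfectRainbowTiling_of_labelling (q := Sum.elim Sigma.fst d) (κ := κ)
    (fun i => (hκ i).trans (card_filter_mem_sumElim q d i).symm) hinj ?_
    (fun a => (hdisj.mono_right (subset_biUnion_of_mem Z (mem_univ a))).symm) ?_
  · rintro (a | k) (b | k') hab
    · exact disjoint_empty_left _
    · exact disjoint_empty_left _
    · exact disjoint_empty_right _
    · exact disjoint_singleton.2 (hx.ne fun h => hab (congr_arg Sum.inr h))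
  · intro a B hB
    obtain ⟨v, hv, hvB⟩ := exists_image_eq_image_diagonal hw ht hB
    rw [← hvB]
    rcases a with ⟨e, j⟩ | k
    · simpa [Z] using (hR v hv).isRainbowClique e (hq e (Nat.ne_zero_of_lt j.2))
    · exact (hR v hv).isRainbowClique_union k

lemma absorbs_diagonal (hR : ∀ v ∈ R, Realizes c r x E d v) (hx : Function.Injective x)
    (hpq : IsExchange E d p q) (hκ : ∀ i, #{α | κ α = i} = ∑ e with i ∈ e, p e) (ht : 0 < t)
    (hw : w ∈ blowUp R t) (hinj : Function.Injective (diagonal κ w))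
    (hdisj : Disjoint (univ.image (diagonal κ w)) (univ.image x)) :
    Absorbs c r (univ.image x) (univ.image (diagonal κ w)) where
  disjoint := hdisj
  tiling := by
    have hR' : ∀ v ∈ R, Realizes c r ![] E ![] v := fun v hv =>
      ⟨(hR v hv).isRainbowClique, fun k => k.elim0⟩
    simpa using hasPerfectRainbowTiling_diagonal_union hR' (Function.injective_of_subsingleton _)
      hpq.mem_of_left (fun i => by simpa using hκ i) ht hw hinj (by simp)
  tiling_union := hasPerfectRainbowTiling_diagonal_union hR hx hpq.mem_of_right
    (fun i => (hκ i).trans (hpq.balance i)) ht hw hinj hdisj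

lemma dens_filter_not_injective_le {J : Type*} [Fintype J] [DecidableEq J] [Nonempty V] :
    (dens {u : J → V | ¬ Function.Injective u} : ℝ) ≤ Fintype.card J ^ 2 / Fintype.card V := by
  calc (dens {u : J → V | ¬ Function.Injective u} : ℝ)
      ≤ dens {u : J → V | ∃ p : J × J, p.1 ≠ p.2 ∧ u p.1 = u p.2} :=
        dens_filter_mono fun u hu => by
          simp only [Function.Injective, not_forall] at hu
          obtain ⟨α, β, h_eq, hne⟩ := hu
          exact ⟨(α, β), hne, h_eq⟩
    _ ≤ ∑ p : J × J, (dens {u : J → V | p.1 ≠ p.2 ∧ u p.1 = u p.2} : ℝ) :=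
        dens_filter_exists_le _
    _ ≤ ∑ p : J × J, 1 / (Fintype.card V : ℝ) := by
        refine sum_le_sum fun p _ => ?_
        by_cases hp : p.1 = p.2
        · simp [hp]
        · exact (dens_filter_mono fun u hu => hu.2).trans (dens_filter_apply_eq_apply_le hp)
    _ = Fintype.card J ^ 2 / Fintype.card V := by
        simp [div_eq_mul_inv, sq]

lemma dens_filter_not_disjoint_le {J : Type*} [Fintype J] [DecidableEq J] [Nonempty V]
    (Z : Finset V) :
    (dens {u : J → V | ¬ Disjoint (univ.image u) Z} : ℝ) ≤
      Fintype.card J * #Z / Fintype.card V := by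
  calc (dens {u : J → V | ¬ Disjoint (univ.image u) Z} : ℝ)
      ≤ dens {u : J → V | ∃ α, u α ∈ Z} :=
        dens_filter_mono fun u hu => by simpa [disjoint_left] using hu
    _ ≤ ∑ α, (dens {u : J → V | u α ∈ Z} : ℝ) := dens_filter_exists_le _
    _ ≤ ∑ _α : J, (dens Z : ℝ) := sum_le_sum fun α _ => dens_filter_apply_mem α Z
    _ = Fintype.card J * #Z / Fintype.card V := by
        simp [nnratCast_dens, mul_div_assoc]

open Classical in
lemma pow_sub_le_dens_absorbs [Nonempty V] (hR : ∀ v ∈ R, Realizes c r x E d v)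
    (hx : Function.Injective x) (hE : ∀ e ∈ E, #e = r) (hpq : IsExchange E d p q)
    (ht : r * ∑ e, p e = t) (ht0 : 0 < t) :
    (dens R : ℝ) ^ t ^ M - (t ^ 2 + t * l) / Fintype.card V ≤
      dens {u : Fin t → V | Absorbs c r (univ.image x) (univ.image u)} := by
  obtain ⟨κ, hκ⟩ := exists_labelling (m := t) (s := fun i => ∑ e with i ∈ e, p e) (by
    rw [sum_sum_filter_mem fun e he => hE e (hpq.mem_of_left e he), ht])
  have h_cover : (dens (blowUp R t) : ℝ) ≤
      dens {u : Fin t → V | Absorbs c r (univ.image x) (univ.image u)} +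
        (dens {u : Fin t → V | ¬ Function.Injective u} +
          dens {u : Fin t → V | ¬ Disjoint (univ.image u) (univ.image x)}) := by
    rw [← dens_filter_diagonal κ, ← dens_filter_diagonal κ, ← dens_filter_diagonal κ,
      ← filter_univ_mem (blowUp R t)]
    refine (dens_filter_mono fun w hw => ?_).trans ((dens_filter_or_le _ _).trans
      (add_le_add_right (dens_filter_or_le _ _) _))
    by_contra! h
    exact h.1 (absorbs_diagonal hR hx hpq hκ ht0 hw h.2.1 h.2.2)
  have h_injective := dens_filter_not_injective_le (J := Fin t) (V := V)
  have h_disjoint := dens_filter_not_disjoint_le (J := Fin t) (univ.image x)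
  have h_card : (#(univ.image x) : ℝ) = l := by
    rw [card_image_of_injective _ hx, card_univ, Fintype.card_fin]
  rw [h_card] at h_disjoint
  rw [Fintype.card_fin] at h_injective h_disjoint
  have h_blowUp := dens_pow_le_dens_blowUp t R
  rw [add_div]
  linarith

end Absorber

section Colours

variable {V K : Type*} {G : SimpleGraph V} {c : G.EdgeLabeling K} {v w y z : V}

/-- `vw` and `vz` are edges of the same colour; in particular this holds for `w = z` whenever `vw`
is an edge. -/
def SameColour (c : G.EdgeLabeling K) (v w z : V) : Prop :=
  ∃ (h : G.Adj v w) (h' : G.Adj v z), c ⟨s(v, w), h⟩ = c ⟨s(v, z), h'⟩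

lemma SameColour.symm : SameColour c v w z → SameColour c v z w :=
  fun ⟨h, h', h_eq⟩ => ⟨h', h, h_eq.symm⟩

lemma SameColour.trans : SameColour c v w z → SameColour c v z y → SameColour c v w y :=
  fun ⟨h, _, h_eq⟩ ⟨_, h', h_eq'⟩ => ⟨h, h', h_eq.trans h_eq'⟩

lemma isRainbowClique_three {T : Finset V} (hT : G.IsNClique 3 T)
    (hcol : ∀ x ∈ T, ∃ y ∈ T, y ≠ x ∧ ∀ z ∈ T, z ≠ y → ¬ SameColour c x y z) :
    IsRainbowClique c 3 T := by
  classical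
  refine ⟨hT, fun ⟨e, he⟩ ⟨f, hf⟩ heT hfT hef => ?_⟩
  have h_card {e : Sym2 V} (he : e ∈ G.edgeSet) : #e.toFinset = 2 :=
    Sym2.card_toFinset_of_not_isDiag e (G.not_isDiag_of_mem_edgeSet he)
  obtain ⟨x, hx⟩ := inter_nonempty_of_card_lt_card_add_card (s := T) (t := e.toFinset)
    (u := f.toFinset) (fun v hv => heT v (Sym2.mem_toFinset.1 hv))
    (fun v hv => hfT v (Sym2.mem_toFinset.1 hv)) (by rw [hT.card_eq, h_card he, h_card hf]; simp)
  rw [mem_inter, Sym2.mem_toFinset, Sym2.mem_toFinset] at hx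
  obtain ⟨⟨y, rfl⟩, ⟨z, rfl⟩⟩ := hx
  rw [G.mem_edgeSet] at he hf
  have hxT := heT x (Sym2.mem_mk_left x y)
  have hyT := heT y (Sym2.mem_mk_right x y)
  have hzT := hfT z (Sym2.mem_mk_right x z)
  by_contra hne
  have hyz : y ≠ z := by rintro rfl; exact hne rfl
  have hT_eq : {x, y, z} = T := by
    refine eq_of_subset_of_card_le (by simp [insert_subset_iff, hxT, hyT, hzT]) ?_
    rw [hT.card_eq, card_triple_eq_three_iff.2 ⟨he.ne, hf.ne, hyz⟩]
  obtain ⟨a, haT, hax, ha⟩ := hcol x hxT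
  have h_same : SameColour c x y z := ⟨he, hf, hef⟩
  simp only [← hT_eq, mem_insert, mem_singleton, hax, false_or] at haT
  rcases haT with rfl | rfl
  exacts [ha z hzT hyz.symm h_same, ha y hyT hyz h_same.symm]

lemma exists_subset_injOn_card_ge {A B : Type*} [DecidableEq B] (N : Finset A) (f : A → B) {b : ℝ}
    (hb : 0 < b) :
    ∃ S ⊆ N, Set.InjOn f S ∧ (∀ w ∈ S, (#{z ∈ N | f z = f w} : ℝ) ≤ b) ∧
      (#(N.image f) : ℝ) - #N / b ≤ #S := by
  let I : Finset B := {k ∈ N.image f | (#{z ∈ N | f z = k} : ℝ) ≤ b}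
  let J : Finset B := {k ∈ N.image f | ¬ (#{z ∈ N | f z = k} : ℝ) ≤ b}
  have h_surj : Set.SurjOn f N I := by
    rw [Set.SurjOn, ← coe_image, coe_subset]
    exact filter_subset _ _
  obtain ⟨S, hSN, h_inj, h_image⟩ := exists_subset_injOn_image_eq_of_surjOn (N : Set A) I h_surj
  have hJ : (#J : ℝ) * b ≤ #N := by
    calc (#J : ℝ) * b = ∑ _k ∈ J, b := by rw [sum_const, nsmul_eq_mul]
      _ ≤ ∑ k ∈ J, (#{z ∈ N | f z = k} : ℝ) :=
        sum_le_sum fun k hk => (not_le.1 (mem_filter.1 hk).2).le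
      _ ≤ ∑ k ∈ N.image f, (#{z ∈ N | f z = k} : ℝ) :=
        sum_le_sum_of_subset_of_nonneg (filter_subset _ _) fun k _ _ => Nat.cast_nonneg _
      _ = #N := by exact_mod_cast (card_eq_sum_card_image f N).symm
  have h_card : (#I : ℝ) + #J = #(N.image f) := by
    exact_mod_cast card_filter_add_card_filter_not _
  refine ⟨S, coe_subset.1 hSN, h_inj, fun w hw => ?_, ?_⟩
  · exact (mem_filter.1 (h_image ▸ mem_image_of_mem f hw : f w ∈ I)).2
  · rw [← le_div_iff₀ hb] at hJ
    rw [← card_image_of_injOn h_inj, h_image]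
    linarith

/-- `S` selects at every vertex neighbours joined to it by edges of distinct colours, such
that every selected colour appears at most `b` times at the vertex. -/
structure IsColourSelection (c : G.EdgeLabeling K) (b : ℝ) (S : V → Finset V) : Prop where
  adj : ∀ v, ∀ w ∈ S v, G.Adj v w
  eq_of_sameColour : ∀ v, ∀ w ∈ S v, ∀ z ∈ S v, SameColour c v w z → w = z
  card_le : ∀ v, ∀ w ∈ S v, ∀ C : Finset V, (∀ z ∈ C, SameColour c v w z) → (#C : ℝ) ≤ b

lemma IsColourSelection.notMem {b : ℝ} {S : V → Finset V} (hS : IsColourSelection c b S) (w : V) :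
    w ∉ S w :=
  fun hw => G.irrefl (hS.adj w w hw)

lemma exists_colourSelection [Fintype V] (c : G.EdgeLabeling K) {b : ℝ} (hb : 0 < b) :
    ∃ S : V → Finset V, IsColourSelection c b S ∧
      ∀ v, (colourDegree c v : ℝ) - Fintype.card V / b ≤ #(S v) := by
  classical
  let f (v w : V) : Option K := if h : G.Adj v w then some (c ⟨s(v, w), h⟩) else none
  have hf {v w z : V} (hw : G.Adj v w) (hz : G.Adj v z) : f v w = f v z ↔ SameColour c v w z := by
    simp [f, SameColour, hw, hz]
  have h_degree (v : V) : colourDegree c v = #(({w | G.Adj v w} : Finset V).image (f v)) := by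
    rw [colourDegree, ← Set.ncard_image_of_injective _ (Option.some_injective K),
      ← Set.ncard_coe_finset]
    congr 1
    refine Set.ext fun k => ⟨?_, fun hk => ?_⟩
    · rintro ⟨_, ⟨⟨e, he⟩, ⟨w, rfl⟩, rfl⟩, rfl⟩
      exact mem_image.2 ⟨w, by simpa using he, dif_pos he⟩
    · obtain ⟨w, hw, rfl⟩ := mem_image.1 hk
      have hw : G.Adj v w := by simpa using hw
      exact ⟨_, ⟨⟨s(v, w), hw⟩, Sym2.mem_mk_left v w, rfl⟩, by simp [f, hw]⟩
  choose S hS_adj hS_inj hS_card hS using fun v =>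
    exists_subset_injOn_card_ge {w | G.Adj v w} (f v) hb
  have h_adj {v w : V} (hw : w ∈ S v) : G.Adj v w := by simpa using hS_adj v hw
  refine ⟨S, ⟨fun v w hw => h_adj hw, fun v w hw z hz h => ?_, fun v w hw C hC => ?_⟩, fun v => ?_⟩
  · exact hS_inj v hw hz ((hf (h_adj hw) (h_adj hz)).2 h)
  · refine le_trans (Nat.cast_le.2 (card_le_card fun z hz => ?_)) (hS_card v w hw)
    have h := hC z hz
    exact mem_filter.2 ⟨by simpa using h.2.1, (hf h.2.1 h.1).2 h.symm⟩
  · rw [h_degree]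
    refine le_trans ?_ (hS v)
    gcongr
    exact card_le_univ _

end Colours

section GoodTuples

variable {V K ι : Type*} [DecidableEq V] [Fintype ι] {G : SimpleGraph V}
  {c : G.EdgeLabeling K} {S : V → Finset V} {b : ℝ} {l : ℕ} {x : Fin l → V} {v : ι → V}

/-- The out-neighbourhoods of the digraph on the index set of the tuple `v` that is induced by the
digraph with out-neighbourhoods `S`. -/
def inducedOut (S : V → Finset V) (v : ι → V) (i : ι) : Finset ι := {j | v j ∈ S (v i)}

lemma mem_inducedOut {i j : ι} : j ∈ inducedOut S v i ↔ v j ∈ S (v i) := mem_filter_univ j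

/-- The digraph induced on the tuple `v` has large out-degrees, each `x k` has many out-neighbours
in the tuple, and among the entries of `v` and `x` no edge of the digraph has the same colour as an
adjacent edge. -/
structure IsGoodTuple (c : G.EdgeLabeling K) (S : V → Finset V) (x : Fin l → V) (v : ι → V) :
    Prop where
  outDegree : ∀ i, 2 * Fintype.card ι < 3 * #(inducedOut S v i)
  outDegree_base : ∀ k, 2 * Fintype.card ι < 3 * #{j | v j ∈ S (x k)}
  colour : ∀ i j m, v j ∈ S (v i) → v m ≠ v j → ¬ SameColour c (v i) (v j) (v m)
  colour_base : ∀ k i j, v j ∈ S (v i) → ¬ SameColour c (v i) (v j) (x k)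

/-- The family `E` of `r`-sets links any two points, and `d` is a tuple of sets that each lack one
point of an `r`-set: the conditions under which `(E, d)` admits an exchange. -/
structure IsLinkedPattern [DecidableEq ι] (r : ℕ) (E : Set (Finset ι)) (d : Fin l → Finset ι) :
    Prop where
  card_eq : ∀ e ∈ E, #e = r
  nonempty : E.Nonempty
  linked : ∀ i j, Linked E i j
  card_base : ∀ k, #(d k) = r - 1

lemma isNClique_image_of_outTriangle (hadj : ∀ w, ∀ z ∈ S w, G.Adj w z) {e : Finset ι}
    (he : OutTriangle (inducedOut S v) e) : G.IsNClique 3 (e.image v) := by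
  have h_adj : ∀ i ∈ e, ∀ j ∈ e, i ≠ j → G.Adj (v i) (v j) := fun i hi j hj hij =>
    (he.2.1 i hi j hj hij).elim (fun h => hadj _ _ (mem_inducedOut.1 h))
      fun h => (hadj _ _ (mem_inducedOut.1 h)).symm
  have h_inj : Set.InjOn v e := fun i hi j hj hij =>
    of_not_not fun hne => (h_adj i hi j hj hne).ne hij
  refine ⟨?_, by rw [card_image_of_injOn h_inj, he.1]⟩
  rw [SimpleGraph.isClique_iff, coe_image, h_inj.pairwise_image]
  exact h_adj

namespace IsGoodTuple

variable (hS : IsColourSelection c b S) (hv : IsGoodTuple c S x v)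
include hS hv

lemma isRainbowClique_image {e : Finset ι} (he : OutTriangle (inducedOut S v) e) :
    IsRainbowClique c 3 (e.image v) := by
  refine isRainbowClique_three (isNClique_image_of_outTriangle hS.adj he) ?_
  simp only [forall_mem_image, exists_mem_image]
  intro i hi
  obtain ⟨j, hj, hij⟩ := he.2.2 i hi
  rw [mem_inducedOut] at hij
  exact ⟨j, hj, (hS.adj _ _ hij).ne', fun m _ hm => hv.colour i j m hij hm⟩

lemma exists_isRainbowClique_base (k : Fin l) :
    ∃ d : Finset ι, #d = 2 ∧ IsRainbowClique c 3 (d.image v ∪ {x k}) := by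
  classical
  obtain ⟨p, hp, q, hq, hqp, hpq, -⟩ := exists_double_edge hv.outDegree (hv.outDegree_base k)
  rw [mem_filter_univ] at hp hq
  rw [mem_inducedOut] at hpq hqp
  have hxp := hS.adj _ _ hp
  have hxq := hS.adj _ _ hq
  have h_adj := hS.adj _ _ hpq
  refine ⟨{p, q}, card_pair fun h => h_adj.ne (congr_arg v h), ?_⟩
  have h_image : ({p, q} : Finset ι).image v ∪ {x k} = {x k, v p, v q} := by
    ext; simp [or_comm, or_left_comm]
  rw [h_image]
  refine isRainbowClique_three (SimpleGraph.is3Clique_triple_iff.2 ⟨hxp, hxq, h_adj⟩) ?_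
  have h_irrefl {w z : V} : ¬ SameColour c w z w := fun h => G.irrefl h.2.1
  have hx : ¬ SameColour c (x k) (v p) (v q) := fun h =>
    h_adj.ne (hS.eq_of_sameColour _ _ hp _ hq h)
  have hvp := hv.colour_base k p q hpq
  have hvq := hv.colour_base k q p hqp
  simp only [mem_insert, mem_singleton, forall_eq_or_imp, forall_eq, exists_eq_or_imp,
    exists_eq_left]
  exact ⟨.inr (.inl ⟨hxp.ne', by simp [h_irrefl, hx]⟩), .inr (.inr ⟨h_adj.ne', by
    simp [h_irrefl, hvp]⟩), .inr (.inl ⟨h_adj.ne, by simp [h_irrefl, hvq]⟩)⟩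

variable [DecidableEq ι]

lemma exists_realizes [Nonempty ι] :
    ∃ E d, IsLinkedPattern 3 E d ∧ Realizes c 3 x E d v := by
  have h_loop (i : ι) : i ∉ inducedOut S v i := fun hi => hS.notMem _ (mem_inducedOut.1 hi)
  choose d hd_card hd using hv.exists_isRainbowClique_base hS
  obtain ⟨i⟩ := ‹Nonempty ι›
  obtain ⟨p, hp, q, hq, hpq, hqp, -⟩ := exists_double_edge hv.outDegree (hv.outDegree i)
  exact ⟨{T | OutTriangle (inducedOut S v) T}, d,
    ⟨fun e he => he.1, ⟨_, .of_double h_loop hqp hpq hq (.inl hp)⟩,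
      linked_of_outDegree h_loop hv.outDegree, hd_card⟩,
    ⟨fun e he => hv.isRainbowClique_image hS he, hd⟩⟩

end IsGoodTuple

end GoodTuples

section GoodTupleDensity

lemma le_one_of_add_le_dens {V : Type*} [Fintype V] {T : Finset V} {δ : ℝ}
    (hT : 2 / 3 + δ ≤ dens T) : δ ≤ 1 := by
  have : (dens T : ℝ) ≤ 1 := by exact_mod_cast dens_le_one
  linarith

variable {V K ι : Type*} [DecidableEq V] [Fintype V] [Nonempty V] [Fintype ι] [DecidableEq ι]
  {G : SimpleGraph V} {c : G.EdgeLabeling K} {S : V → Finset V} {b δ : ℝ}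

lemma two_mul_lt_three_mul_of_lt {m a : ℕ} (hm : 4 / 3 ≤ δ * (m - 1))
    (ha : (2 / 3 + δ - δ / 2) * (m - 1) < a) : 2 * m < 3 * a := by
  have : (2 * m : ℝ) < 3 * a := by linarith
  exact_mod_cast this

lemma dens_not_outDegree_le (hdeg : ∀ w, 2 / 3 + δ ≤ dens (S w)) (hδ0 : 0 ≤ δ)
    (hι : 4 / 3 ≤ δ * (Fintype.card ι - 1)) (i : ι) :
    (dens {v : ι → V | ¬ 2 * Fintype.card ι < 3 * #(inducedOut S v i)} : ℝ) ≤
      Real.exp (-(δ ^ 2 * (Fintype.card ι - 1) / 16)) := by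
  have hδ1 := le_one_of_add_le_dens (hdeg (Classical.arbitrary V))
  refine (dens_filter_mono fun v hv => ?_).trans
    ((dens_card_filter_mem_apply_le i hdeg (s := δ / 2) (by linarith) (by linarith)).trans_eq ?_)
  · exact not_lt.1 fun h => hv (two_mul_lt_three_mul_of_lt hι h)
  · ring_nf

lemma dens_not_outDegree_base_le {T : Finset V} (hT : 2 / 3 + δ ≤ dens T) (hδ0 : 0 ≤ δ)
    (hι : 4 / 3 ≤ δ * (Fintype.card ι - 1)) :
    (dens {v : ι → V | ¬ 2 * Fintype.card ι < 3 * #{j | v j ∈ T}} : ℝ) ≤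
      Real.exp (-(δ ^ 2 * (Fintype.card ι - 1) / 16)) := by
  have hδ1 := le_one_of_add_le_dens hT
  refine (dens_filter_mono fun v hv => ?_).trans
    ((dens_card_filter_mem_le hT (s := δ / 2) (by linarith) (by linarith)).trans
      (Real.exp_le_exp.2 ?_))
  · exact not_lt.1 fun h => hv (two_mul_lt_three_mul_of_lt hι (h.trans_le' (by nlinarith)))
  · nlinarith [sq_nonneg δ]

open Classical in
lemma dens_sameColour_le (hS : IsColourSelection c b S) (hb : 0 ≤ b) (i j m : ι) :
    (dens {v : ι → V | v j ∈ S (v i) ∧ v m ≠ v j ∧ SameColour c (v i) (v j) (v m)} : ℝ) ≤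
      b / Fintype.card V := by
  refine dens_filter_le_of_update m fun v => ?_
  rw [nnratCast_dens]
  gcongr
  by_cases hi : i = m
  · subst hi
    simpa [SameColour] using hb
  by_cases hj : j = m
  · subst hj
    simpa using hb
  simp only [Function.update_of_ne hi, Function.update_of_ne hj, Function.update_self]
  by_cases h : v j ∈ S (v i)
  · exact hS.card_le _ _ h _ fun z hz => (mem_filter.1 hz).2.2.2
  · simpa [h] using hb

open Classical in
lemma dens_sameColour_base_le (hS : IsColourSelection c b S) (y : V) (i j : ι) :
    (dens {v : ι → V | v j ∈ S (v i) ∧ SameColour c (v i) (v j) y} : ℝ) ≤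
      1 / Fintype.card V := by
  refine dens_filter_le_of_update j fun v => ?_
  rw [nnratCast_dens]
  gcongr
  by_cases hi : i = j
  · subst hi
    simp [hS.notMem]
  simp only [Function.update_of_ne hi, Function.update_self]
  exact_mod_cast card_le_one.2 fun w hw z hz => by
    rw [mem_filter_univ] at hw hz
    exact hS.eq_of_sameColour _ _ hw.1 _ hz.1 (hw.2.trans hz.2.symm)

open Classical in
lemma dens_exists_not_outDegree_le (hdeg : ∀ w, 2 / 3 + δ ≤ dens (S w)) (hδ0 : 0 ≤ δ)
    (hι : 4 / 3 ≤ δ * (Fintype.card ι - 1)) {l : ℕ} (x : Fin l → V) :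
    (dens {v : ι → V | (∃ i, ¬ 2 * Fintype.card ι < 3 * #(inducedOut S v i)) ∨
        ∃ k, ¬ 2 * Fintype.card ι < 3 * #{j | v j ∈ S (x k)}} : ℝ) ≤
      (Fintype.card ι + l) * Real.exp (-(δ ^ 2 * (Fintype.card ι - 1) / 16)) := by
  refine (dens_filter_or_le _ _).trans ?_
  rw [add_mul]
  gcongr
  · exact dens_filter_exists_le_card_mul fun i => dens_not_outDegree_le hdeg hδ0 hι i
  · simpa using dens_filter_exists_le_card_mul fun k : Fin l =>
      dens_not_outDegree_base_le (ι := ι) (hdeg (x k)) hδ0 hι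

open Classical in
lemma dens_exists_sameColour_le (hS : IsColourSelection c b S) (hb : 0 ≤ b) {l : ℕ}
    (x : Fin l → V) :
    (dens {v : ι → V | (∃ p : ι × ι × ι, v p.2.1 ∈ S (v p.1) ∧ v p.2.2 ≠ v p.2.1 ∧
          SameColour c (v p.1) (v p.2.1) (v p.2.2)) ∨
        ∃ p : Fin l × ι × ι, v p.2.2 ∈ S (v p.2.1) ∧
          SameColour c (v p.2.1) (v p.2.2) (x p.1)} : ℝ) ≤
      (Fintype.card ι ^ 3 * b + l * Fintype.card ι ^ 2) / Fintype.card V := by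
  refine (dens_filter_or_le _ _).trans ((add_le_add
    (dens_filter_exists_le_card_mul fun p : ι × ι × ι =>
      dens_sameColour_le hS hb p.1 p.2.1 p.2.2)
    (dens_filter_exists_le_card_mul fun p : Fin l × ι × ι =>
      dens_sameColour_base_le hS (x p.1) p.2.1 p.2.2)).trans_eq ?_)
  simp only [Fintype.card_prod, Fintype.card_fin]
  push_cast
  ring

open Classical in
lemma dens_not_isGoodTuple_le (hS : IsColourSelection c b S) (hb : 0 ≤ b)
    (hdeg : ∀ w, 2 / 3 + δ ≤ dens (S w)) (hδ0 : 0 ≤ δ)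
    (hι : 4 / 3 ≤ δ * (Fintype.card ι - 1)) {l : ℕ} (x : Fin l → V) :
    (dens {v : ι → V | ¬ IsGoodTuple c S x v} : ℝ) ≤
      (Fintype.card ι + l) * Real.exp (-(δ ^ 2 * (Fintype.card ι - 1) / 16)) +
        (Fintype.card ι ^ 3 * b + l * Fintype.card ι ^ 2) / Fintype.card V := by
  refine (dens_filter_mono fun v hv => ?_).trans ((dens_filter_or_le _ _).trans
    (add_le_add (dens_exists_not_outDegree_le hdeg hδ0 hι x)
      (dens_exists_sameColour_le hS hb x)))
  contrapose! hv
  exact ⟨hv.1.1, hv.1.2, fun i j m => hv.2.1 (i, j, m), fun k i j => hv.2.2 (k, i, j)⟩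

end GoodTupleDensity

section ManyAbsorbers

lemma exists_forall_ge_mul_exp_le {δ : ℝ} (hδ : 0 < δ) (l : ℕ) :
    ∃ M : ℕ, 0 < M ∧ 4 / 3 ≤ δ * (M - 1) ∧
      (M + l) * Real.exp (-(δ ^ 2 * (M - 1) / 16)) ≤ 1 / 4 := by
  have h_top : Filter.Tendsto (fun M : ℕ => δ ^ 2 / 16 * ((M : ℝ) - 1)) .atTop .atTop :=
    (Filter.tendsto_atTop_add_const_right _ (-1) tendsto_natCast_atTop_atTop).const_mul_atTop
      (by positivity)
  have h_linear : Filter.Tendsto (fun y : ℝ => 16 / δ ^ 2 * (y ^ 1 * Real.exp (-y)) +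
      (1 + l) * (y ^ 0 * Real.exp (-y))) .atTop (nhds 0) := by
    simpa using ((Real.tendsto_pow_mul_exp_neg_atTop_nhds_zero 1).const_mul (16 / δ ^ 2)).add
      ((Real.tendsto_pow_mul_exp_neg_atTop_nhds_zero 0).const_mul (1 + (l : ℝ)))
  obtain ⟨M, hM0, hMδ, hM⟩ := ((Filter.eventually_gt_atTop 0).and
    ((h_top.eventually_ge_atTop (4 / 3 * (δ / 16))).and
      ((h_linear.comp h_top).eventually
        (eventually_le_nhds (by norm_num : (0 : ℝ) < 1 / 4))))).exists
  refine ⟨M, hM0, ?_, ?_⟩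
  · refine le_of_mul_le_mul_right (hMδ.trans_eq ?_) (by positivity : 0 < δ / 16)
    ring
  · refine le_of_eq_of_le ?_ hM
    simp only [Function.comp_apply]
    rw [div_mul_eq_mul_div]
    field_simp
    ring

variable {V K : Type*} [Fintype V] {G : SimpleGraph V} {c : G.EdgeLabeling K} {δ : ℝ}

lemma exists_colourSelection_dens [Nonempty V] {α γ : ℝ} (hγ : 0 < γ)
    (hV : 1 / γ ≤ δ * Fintype.card V) (hc : (α + δ) * Fintype.card V ≤ minColourDegree c) :
    ∃ S, IsColourSelection c (γ * Fintype.card V) S ∧ ∀ v, α ≤ dens (S v) := by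
  have hn : (0 : ℝ) < Fintype.card V := by exact_mod_cast Fintype.card_pos
  obtain ⟨S, hS, hS_card⟩ := exists_colourSelection c (mul_pos hγ hn)
  refine ⟨S, hS, fun v => ?_⟩
  have h_min : (minColourDegree c : ℝ) ≤ colourDegree c v := by
    exact_mod_cast ciInf_le' (fun v => colourDegree c v) v
  have h_loss : (Fintype.card V : ℝ) / (γ * Fintype.card V) = 1 / γ := by field_simp
  rw [nnratCast_dens, le_div_iff₀ hn]
  linarith [hS_card v]

open Classical in
lemma exists_half_le_dens_isGoodTuple [DecidableEq V] [Nonempty V] {M l : ℕ} (hδ : 0 < δ)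
    (hM0 : 0 < M) (hMδ : 4 / 3 ≤ δ * (M - 1))
    (hM : (M + l) * Real.exp (-(δ ^ 2 * (M - 1) / 16)) ≤ 1 / 4)
    (hV : 8 * M ^ 3 / δ ≤ Fintype.card V) (hV' : 8 * l * M ^ 2 ≤ (Fintype.card V : ℝ))
    (hc : (2 / 3 + 2 * δ) * Fintype.card V ≤ minColourDegree c) :
    ∃ b S, IsColourSelection c b S ∧
      ∀ x : Fin l → V, 1 / 2 ≤ (dens {v : Fin M → V | IsGoodTuple c S x v} : ℝ) := by
  have hn : (0 : ℝ) < Fintype.card V := by exact_mod_cast Fintype.card_pos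
  have hM0' : (0 : ℝ) < M := by exact_mod_cast hM0
  rw [div_le_iff₀' hδ] at hV
  obtain ⟨S, hS, hdeg⟩ := exists_colourSelection_dens (c := c) (α := 2 / 3 + δ)
    (γ := 1 / (8 * M ^ 3)) (δ := δ) (by positivity) (by rwa [one_div_one_div])
    (by linarith)
  refine ⟨_, S, hS, fun x => ?_⟩
  have h_bad := dens_not_isGoodTuple_le (ι := Fin M) hS (by positivity) hdeg hδ.le
    (by simpa using hMδ) x
  have h_colour : ((M : ℝ) ^ 3 * (1 / (8 * M ^ 3) * Fintype.card V) + l * M ^ 2) /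
      Fintype.card V ≤ 1 / 4 := by
    rw [div_le_iff₀ hn]
    field_simp
    linarith
  have h_total : (dens {v : Fin M → V | IsGoodTuple c S x v} : ℝ) +
      dens {v : Fin M → V | ¬ IsGoodTuple c S x v} = 1 := by
    exact_mod_cast (dens_filter_add_dens_filter_not_eq_dens _).trans dens_univ
  rw [Fintype.card_fin] at h_bad
  linarith

open Classical in
lemma exists_isLinkedPattern_dens_realizes_ge [DecidableEq V] {ι : Type*} [Fintype ι] [Nonempty ι]
    [DecidableEq ι] {l : ℕ} {b : ℝ} {S : V → Finset V} (hS : IsColourSelection c b S)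
    {x : Fin l → V} {η : ℝ} (hη : 0 < η)
    (hgood : Fintype.card (Set (Finset ι) × (Fin l → Finset ι)) * η ≤
      dens {v : ι → V | IsGoodTuple c S x v}) :
    ∃ E d, IsLinkedPattern 3 E d ∧ η ≤ (dens {v : ι → V | Realizes c 3 x E d v} : ℝ) := by
  let P (p : Set (Finset ι) × (Fin l → Finset ι)) (v : ι → V) : Prop :=
    IsLinkedPattern 3 p.1 p.2 ∧ Realizes c 3 x p.1 p.2 v
  have h_exists (v : ι → V) (hv : IsGoodTuple c S x v) : ∃ p, P p v :=
    let ⟨E, d, h⟩ := hv.exists_realizes hS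
    ⟨(E, d), h⟩
  obtain ⟨⟨E, d⟩, -, hp⟩ := exists_le_of_sum_le
    (f := fun _ => η) (g := fun p => (dens {v | P p v} : ℝ)) univ_nonempty (by
      rw [sum_const, card_univ, nsmul_eq_mul]
      exact (hgood.trans (dens_filter_mono h_exists)).trans (dens_filter_exists_le P))
  refine ⟨E, d, ?_, hp.trans (dens_filter_mono fun v hv => hv.2)⟩
  have h_pos : 0 < dens {v | P (E, d) v} := by exact_mod_cast hη.trans_le hp
  obtain ⟨v, hv⟩ := dens_pos.1 h_pos
  exact ((mem_filter_univ v).1 hv).1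

lemma exists_forall_isExchange (r : ℕ) (ι : Type*) [Fintype ι] [Nonempty ι] [DecidableEq ι] :
    ∃ N, 0 < N ∧ ∀ (E : Set (Finset ι)) (d : Fin r → Finset ι), IsLinkedPattern r E d →
      ∃ p q, IsExchange E d p q ∧ ∑ e, p e = N := by
  have h : ∀ᶠ N in Filter.atTop, ∀ (E : Set (Finset ι)) (d : Fin r → Finset ι),
      IsLinkedPattern r E d → ∃ p q, IsExchange E d p q ∧ ∑ e, p e = N := by
    simp only [Filter.eventually_all]
    exact fun E d h => eventually_exists_isExchange h.card_eq h.nonempty h.linked h.card_base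
  exact ((Filter.eventually_gt_atTop 0).and h).exists

open Classical in
lemma pow_sub_le_dens_absorbs_of_isGoodTuple [DecidableEq V] [Nonempty V] {M N : ℕ} [NeZero M]
    (hN0 : 0 < N)
    (hN : ∀ (E : Set (Finset (Fin M))) (d : Fin 3 → Finset (Fin M)), IsLinkedPattern 3 E d →
      ∃ p q, IsExchange E d p q ∧ ∑ e, p e = N)
    {b : ℝ} {S : V → Finset V} (hS : IsColourSelection c b S) {x : Fin 3 → V}
    (hx : Function.Injective x) {η : ℝ} (hη : 0 < η)
    (hgood : Fintype.card (Set (Finset (Fin M)) × (Fin 3 → Finset (Fin M))) * η ≤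
      dens {v : Fin M → V | IsGoodTuple c S x v}) :
    η ^ (3 * N) ^ M - ((3 * N) ^ 2 + 3 * N * 3) / Fintype.card V ≤
      dens {u : Fin (3 * N) → V | Absorbs c 3 (univ.image x) (univ.image u)} := by
  obtain ⟨E, d, hEd, hR⟩ := exists_isLinkedPattern_dens_realizes_ge hS hη hgood
  obtain ⟨p, q, hpq, h_sum⟩ := hN E d hEd
  have h_absorb := pow_sub_le_dens_absorbs (c := c) (t := 3 * N)
    (fun v hv => (mem_filter_univ v).1 hv) hx hEd.card_eq hpq (by rw [h_sum]) (by positivity)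
  rw [Nat.cast_mul, Nat.cast_ofNat] at h_absorb
  have h_pow := pow_le_pow_left₀ hη.le hR ((3 * N) ^ M)
  linarith

open Classical in
lemma exists_le_dens_absorbs {ε : ℝ} (hε : 0 < ε) :
    ∃ N : ℕ, 0 < N ∧ ∃ η : ℝ, 0 < η ∧ ∃ n₀ : ℕ, ∀ (V K : Type*) [Fintype V] [DecidableEq V]
      (G : SimpleGraph V) (c : G.EdgeLabeling K), n₀ ≤ Fintype.card V →
      (2 / 3 + ε) * Fintype.card V ≤ minColourDegree c → ∀ X : Finset V, #X = 3 →
        η ≤ (dens {u : Fin (3 * N) → V | Absorbs c 3 X (univ.image u)} : ℝ) := by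
  obtain ⟨M, hM0, hMε, hM⟩ := exists_forall_ge_mul_exp_le (half_pos hε) 3
  have : NeZero M := ⟨hM0.ne'⟩
  obtain ⟨N, hN0, hN⟩ := exists_forall_isExchange 3 (Fin M)
  obtain ⟨η, hη, hη_card⟩ : ∃ η : ℝ, 0 < η ∧
      Fintype.card (Set (Finset (Fin M)) × (Fin 3 → Finset (Fin M))) * η = 1 / 2 :=
    ⟨_, by positivity, mul_div_cancel₀ _ (by positivity)⟩
  obtain ⟨ρ, hρ, hρ_eq⟩ : ∃ ρ, 0 < ρ ∧ η ^ (3 * N) ^ M = ρ := ⟨_, by positivity, rfl⟩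
  obtain ⟨n₀, hn₀⟩ := exists_nat_ge (1 + 8 * M ^ 3 / (ε / 2) + 8 * 3 * M ^ 2 +
    ((3 * N) ^ 2 + 3 * N * 3) / (ρ / 2) : ℝ)
  refine ⟨N, hN0, ρ / 2, by positivity, n₀, fun V K _ _ G c hn hc X hX => ?_⟩
  have h_nonneg : (0 : ℝ) ≤ 8 * M ^ 3 / (ε / 2) ∧ (0 : ℝ) ≤ 8 * 3 * M ^ 2 ∧
    0 ≤ ((3 * N) ^ 2 + 3 * N * 3) / (ρ / 2) := ⟨by positivity, by positivity, by positivity⟩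
  have hV : 1 + 8 * M ^ 3 / (ε / 2) + 8 * 3 * M ^ 2 + ((3 * N) ^ 2 + 3 * N * 3) / (ρ / 2) ≤
    (Fintype.card V : ℝ) := hn₀.trans (by exact_mod_cast hn)
  have hV0 : (0 : ℝ) < Fintype.card V := by linarith
  have : Nonempty V := Fintype.card_pos_iff.1 (by exact_mod_cast hV0)
  obtain ⟨x, hx, rfl⟩ : ∃ x : Fin 3 → V, Function.Injective x ∧ univ.image x = X := by
    obtain ⟨x, y, z, hxy, hxz, hyz, rfl⟩ := card_eq_three.1 hX
    exact ⟨![x, y, z], by simp [Function.Injective, Fin.forall_fin_succ, *, Ne.symm], by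
      ext; simp [Fin.exists_fin_succ, eq_comm]⟩
  obtain ⟨b, S, hS, hgood⟩ := exists_half_le_dens_isGoodTuple (c := c) (l := 3) (half_pos hε) hM0
    hMε hM (by linarith) (by push_cast; linarith) (by linarith)
  have h_absorb := pow_sub_le_dens_absorbs_of_isGoodTuple hN0 hN hS hx hη
    (hη_card.trans_le (hgood x))
  have h_error : ((3 * N) ^ 2 + 3 * N * 3) / (Fintype.card V : ℝ) ≤ ρ / 2 := by
    rw [div_le_comm₀ hV0 (by positivity)]
    linarith
  linarith

end ManyAbsorbers

section Selection

variable {V I J α : Type*}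

lemma exists_sum_mul_ite_le [Fintype α] [Nonempty α] [DecidableEq α] {𝒳 : Finset I} {f : I → ℝ}
    (hf : ∀ X ∈ 𝒳, 0 ≤ f X) {B : I → Finset α} {β : ℝ} (hB : ∀ X ∈ 𝒳, β ≤ dens (B X)) :
    ∃ a, ∑ X ∈ 𝒳, f X * (if a ∈ B X then 1 / 2 else 1) ≤
      Real.exp (-(β / 2)) * ∑ X ∈ 𝒳, f X := by
  have h_expect (X : I) :
      𝔼 a, f X * (if a ∈ B X then 1 / 2 else 1) = f X * (1 - dens (B X) / 2) := by
    have h_indicator (a : α) : (if a ∈ B X then 1 / 2 else 1 : ℝ) =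
        1 - (B X : Set α).indicator 1 a / 2 := by
      by_cases ha : a ∈ B X <;> norm_num [ha]
    simp only [h_indicator, ← mul_expect, expect_sub_distrib, ← expect_div, expect_indicator_one,
      Fintype.expect_const]
  have h_le : 𝔼 a, ∑ X ∈ 𝒳, f X * (if a ∈ B X then 1 / 2 else 1) ≤
      Real.exp (-(β / 2)) * ∑ X ∈ 𝒳, f X := by
    rw [expect_sum_comm, mul_sum]
    refine sum_le_sum fun X hX => ?_
    rw [h_expect, mul_comm]
    refine mul_le_mul_of_nonneg_right ?_ (hf X hX)
    linarith [hB X hX, Real.add_one_le_exp (-(β / 2))]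
  obtain ⟨a, -, ha⟩ := exists_le_of_expect_le univ_nonempty h_le
  exact ⟨a, ha⟩

/-- The hypothesis says that `r` rounds of the greedy choice outweigh the union bound. -/
lemma le_card_filter_mem_of_sum_pow_le [DecidableEq α] {𝒳 : Finset I} {A : I → Finset α} {η : ℝ}
    {F : Finset α} {r : ℕ} {X : I} (hX : X ∈ 𝒳)
    (hF : ∑ X ∈ 𝒳, (1 / 2 : ℝ) ^ #{u ∈ F | u ∈ A X} ≤ Real.exp (-(η / 4)) ^ r * #𝒳) {h : ℝ}
    (hr : #𝒳 * Real.exp (h - η / 4 * r) < 1) : h ≤ #{u ∈ F | u ∈ A X} := by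
  have h_half : Real.exp (-1) ≤ 1 / 2 := by
    rw [Real.exp_neg, one_div]
    exact inv_anti₀ two_pos (by linarith [Real.add_one_le_exp 1])
  by_contra! h_lt
  have h_exp : Real.exp (-h) ≤ Real.exp (-(η / 4)) ^ r * #𝒳 := calc
    Real.exp (-h) ≤ Real.exp (#{u ∈ F | u ∈ A X} * (-1)) := Real.exp_le_exp.2 (by linarith)
    _ = Real.exp (-1) ^ #{u ∈ F | u ∈ A X} := Real.exp_nat_mul _ _
    _ ≤ (1 / 2) ^ #{u ∈ F | u ∈ A X} := by gcongr
    _ ≤ ∑ X ∈ 𝒳, (1 / 2 : ℝ) ^ #{u ∈ F | u ∈ A X} :=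
      single_le_sum (f := fun X => (1 / 2 : ℝ) ^ #{u ∈ F | u ∈ A X}) (fun _ _ => by positivity) hX
    _ ≤ _ := hF
  have h_one := mul_le_mul_of_nonneg_left h_exp (Real.exp_pos h).le
  rw [← Real.exp_add, add_neg_cancel, Real.exp_zero, ← Real.exp_nat_mul, ← mul_assoc,
    ← Real.exp_add] at h_one
  refine hr.not_ge (h_one.trans_eq ?_)
  rw [mul_comm]
  ring_nf

lemma exists_forall_pow_mul_exp_lt (k : ℕ) (C : ℝ) {b : ℝ} (hb : 0 < b) :
    ∃ n₀ : ℕ, ∀ n : ℕ, n₀ ≤ n → C * (n : ℝ) ^ k * Real.exp (-(b * n)) < 1 := by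
  have h_top : Filter.Tendsto (fun n : ℕ => b * (n : ℝ)) .atTop .atTop :=
    tendsto_natCast_atTop_atTop.const_mul_atTop hb
  have h_zero := ((Real.tendsto_pow_mul_exp_neg_atTop_nhds_zero k).comp h_top).const_mul (C / b ^ k)
  rw [mul_zero] at h_zero
  obtain ⟨n₀, hn₀⟩ := Filter.eventually_atTop.1 (h_zero.eventually (gt_mem_nhds one_pos))
  refine ⟨n₀, fun n hn => (hn₀ n hn).trans_eq' ?_⟩
  simp only [Function.comp_apply, mul_pow]
  field_simp

variable [Fintype V] [DecidableEq V] [Nonempty V] [Fintype J] [DecidableEq J]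

lemma half_le_dens_filter_disjoint {η : ℝ} {A : Finset (J → V)} (hA : η ≤ dens A) {Z : Finset V}
    (hZ : Fintype.card J * #Z ≤ η / 2 * Fintype.card V) :
    η / 2 ≤ dens {u ∈ A | Disjoint (univ.image u) Z} := by
  have h_split : (dens A : ℝ) ≤ dens {u ∈ A | Disjoint (univ.image u) Z} +
      dens {u : J → V | ¬ Disjoint (univ.image u) Z} := by
    rw [← dens_filter_add_dens_filter_not_eq_dens (fun u => Disjoint (univ.image u) Z)]
    push_cast
    gcongr
    exact subset_univ A
  have h_bad : (dens {u : J → V | ¬ Disjoint (univ.image u) Z} : ℝ) ≤ η / 2 :=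
    (dens_filter_not_disjoint_le Z).trans <|
      (div_le_iff₀ (by exact_mod_cast Fintype.card_pos)).2 hZ
  linarith

variable [Nonempty J] {𝒳 : Finset I} {A : I → Finset (J → V)} {η : ℝ}

lemma exists_sum_pow_card_filter_mem_le_exp_mul (hA : ∀ X ∈ 𝒳, η ≤ dens (A X))
    {F : Finset (J → V)} (hF : (F : Set (J → V)).PairwiseDisjoint (univ.image ·))
    (hFη : Fintype.card J ^ 2 * #F ≤ η / 2 * Fintype.card V) :
    ∃ F' : Finset (J → V), #F' ≤ #F + 1 ∧
      (F' : Set (J → V)).PairwiseDisjoint (univ.image ·) ∧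
      ∑ X ∈ 𝒳, (1 / 2 : ℝ) ^ #{u ∈ F' | u ∈ A X} ≤
        Real.exp (-(η / 4)) * ∑ X ∈ 𝒳, (1 / 2 : ℝ) ^ #{u ∈ F | u ∈ A X} := by
  let Z : Finset V := F.biUnion (univ.image ·)
  have hZ : (Fintype.card J * #Z : ℝ) ≤ η / 2 * Fintype.card V := by
    have hZ_card : #Z ≤ #F * Fintype.card J :=
      card_biUnion_le_card_mul _ _ _ fun u _ => card_image_le
    refine le_trans ?_ hFη
    exact_mod_cast (Nat.mul_le_mul_left _ hZ_card).trans_eq (by ring)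
  obtain ⟨a, ha⟩ := exists_sum_mul_ite_le (f := fun X => (1 / 2 : ℝ) ^ #{u ∈ F | u ∈ A X})
    (fun X _ => by positivity) fun X hX => half_le_dens_filter_disjoint (hA X hX) hZ
  rw [div_div, (by norm_num : (2 : ℝ) * 2 = 4)] at ha
  by_cases haZ : Disjoint (univ.image a) Z
  · have haF : a ∉ F := fun h => (univ_nonempty.image a).ne_empty
      (disjoint_self.1 (haZ.mono_right (subset_biUnion_of_mem (univ.image ·) h)))
    refine ⟨insert a F, card_insert_le a F, ?_, ha.trans' (sum_le_sum fun X _ => ?_)⟩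
    · rw [coe_insert, Set.pairwiseDisjoint_insert_of_notMem (mem_coe.not.2 haF)]
      exact ⟨hF, (disjoint_biUnion_right _ _ _).1 haZ⟩
    · by_cases haX : a ∈ A X
      · simp [filter_insert, haX, haZ, haF, pow_succ]
      · simp [filter_insert, haX]
  · exact ⟨F, Nat.le_succ _, hF, ha.trans' (sum_le_sum fun X _ => by simp [haZ])⟩

lemma exists_pairwiseDisjoint_sum_pow_card_filter_mem_le (hA : ∀ X ∈ 𝒳, η ≤ dens (A X)) {r : ℕ}
    (hr : Fintype.card J ^ 2 * r ≤ η / 2 * Fintype.card V) :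
    ∃ F : Finset (J → V), #F ≤ r ∧ (F : Set (J → V)).PairwiseDisjoint (univ.image ·) ∧
      ∑ X ∈ 𝒳, (1 / 2 : ℝ) ^ #{u ∈ F | u ∈ A X} ≤ Real.exp (-(η / 4)) ^ r * #𝒳 := by
  induction r with
  | zero => exact ⟨∅, by simp⟩
  | succ r ih =>
    have h_mono (s : ℕ) (hs : s ≤ r + 1) :
        (Fintype.card J ^ 2 * s : ℝ) ≤ η / 2 * Fintype.card V :=
      hr.trans' (by gcongr)
    obtain ⟨F, hF_card, hF_disj, hF⟩ := ih (h_mono r r.le_succ)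
    obtain ⟨F', hF'_card, hF'_disj, hF'⟩ :=
      exists_sum_pow_card_filter_mem_le_exp_mul hA hF_disj (h_mono #F (by lia))
    refine ⟨F', by lia, hF'_disj, hF'.trans ?_⟩
    rw [pow_succ', mul_assoc]
    gcongr

lemma exists_forall_exists_pairwiseDisjoint (J : Type*) [Fintype J] [DecidableEq J] [Nonempty J]
    (k : ℕ) {η κ : ℝ} (hη : 0 < η) (hκ : 0 < κ) (hJκ : 2 * Fintype.card J ^ 2 * κ ≤ η) :
    ∃ n₀ : ℕ, ∀ (V : Type*) [Fintype V] [DecidableEq V], n₀ ≤ Fintype.card V →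
      ∀ A : Finset V → Finset (J → V), (∀ X, #X = k → η ≤ dens (A X)) →
        ∃ F : Finset (J → V), #F ≤ κ * Fintype.card V ∧
          (F : Set (J → V)).PairwiseDisjoint (univ.image ·) ∧
          ∀ X, #X = k → η * κ / 8 * Fintype.card V ≤ #{u ∈ F | u ∈ A X} := by
  obtain ⟨n₀, hn₀⟩ := exists_forall_pow_mul_exp_lt k (Real.exp (η / 4)) (b := η * κ / 8)
    (by positivity)
  refine ⟨max n₀ 1, fun V _ _ hn A hA => ?_⟩
  have : Nonempty V := Fintype.card_pos_iff.1 (le_of_max_le_right hn)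
  have h_floor : (⌊κ * Fintype.card V⌋₊ : ℝ) ≤ κ * Fintype.card V := Nat.floor_le (by positivity)
  obtain ⟨F, hF_card, hF_disj, hF⟩ := exists_pairwiseDisjoint_sum_pow_card_filter_mem_le
    (𝒳 := powersetCard k univ) (r := ⌊κ * Fintype.card V⌋₊)
    (fun X hX => hA X (mem_powersetCard.1 hX).2) (by
      calc (Fintype.card J ^ 2 * ⌊κ * Fintype.card V⌋₊ : ℝ)
          ≤ Fintype.card J ^ 2 * (κ * Fintype.card V) := by gcongr
        _ = 2 * Fintype.card J ^ 2 * κ / 2 * Fintype.card V := by ring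
        _ ≤ η / 2 * Fintype.card V := by gcongr)
  refine ⟨F, h_floor.trans' (by exact_mod_cast hF_card), hF_disj, fun X hX =>
    le_card_filter_mem_of_sum_pow_le (mem_powersetCard.2 ⟨subset_univ X, hX⟩) hF ?_⟩
  have h_card : (#(powersetCard k (univ : Finset V)) : ℝ) ≤ Fintype.card V ^ k := by
    rw [card_powersetCard, card_univ]
    exact_mod_cast Nat.choose_le_pow _ _
  have h_exponent : η * κ / 8 * Fintype.card V - η / 4 * ⌊κ * Fintype.card V⌋₊ ≤
      η / 4 + -(η * κ / 8 * Fintype.card V) := by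
    nlinarith [Nat.sub_one_lt_floor (κ * Fintype.card V)]
  calc (#(powersetCard k (univ : Finset V)) : ℝ) *
        Real.exp (η * κ / 8 * Fintype.card V - η / 4 * ⌊κ * Fintype.card V⌋₊)
      ≤ Fintype.card V ^ k * Real.exp (η / 4 + -(η * κ / 8 * Fintype.card V)) := by gcongr
    _ = Real.exp (η / 4) * Fintype.card V ^ k * Real.exp (-(η * κ / 8 * Fintype.card V)) := by
        rw [Real.exp_add]
        ring
    _ < 1 := hn₀ _ (le_of_max_le_left hn)

end Selection

section Assembly

variable {V K J : Type*} [DecidableEq V] [Fintype J] {G : SimpleGraph V} {c : G.EdgeLabeling K}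
  {r : ℕ}

open Classical in
/-- Members of `F` absorbing no `r`-set need not have a tiling, so they are discarded. -/
lemma exists_hasPerfectRainbowTiling_union (hr : 0 < r) {F : Finset (J → V)}
    (hF : (F : Set (J → V)).PairwiseDisjoint (univ.image ·)) {b : ℝ}
    (hb : ∀ X, #X = r → b ≤ #{u ∈ F | Absorbs c r X (univ.image u)}) :
    ∃ W : Finset V, #W ≤ #F * Fintype.card J ∧ HasPerfectRainbowTiling c r W ∧
      ∀ U, Disjoint U W → #U ≤ r * b → r ∣ #U → HasPerfectRainbowTiling c r (U ∪ W) := by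
  let F₀ : Finset (J → V) := {u ∈ F | ∃ X, #X = r ∧ Absorbs c r X (univ.image u)}
  have hF₀ : (F₀ : Set (J → V)).PairwiseDisjoint (univ.image ·) :=
    hF.subset (coe_subset.2 (filter_subset _ F))
  have h_tiling : ∀ u ∈ F₀, HasPerfectRainbowTiling c r (univ.image u) := fun u hu =>
    let ⟨_, _, hX⟩ := (mem_filter.1 hu).2
    hX.tiling
  refine ⟨F₀.biUnion (univ.image ·), ?_, .biUnion hF₀ h_tiling, fun U hUW hU ⟨k, hk⟩ => ?_⟩
  · exact (card_biUnion_le_card_mul _ _ _ fun u _ => card_image_le).trans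
      (Nat.mul_le_mul_right _ (card_filter_le F _))
  · have hkb : (k : ℝ) ≤ b := by
      rw [hk, Nat.cast_mul] at hU
      exact le_of_mul_le_mul_left hU (by exact_mod_cast hr)
    exact hasPerfectRainbowTiling_union_biUnion hF₀ h_tiling hUW hk fun X _ hX =>
      ⟨{u ∈ F | Absorbs c r X (univ.image u)}, monotone_filter_right F fun u _ hu => ⟨X, hX, hu⟩,
        by exact_mod_cast hkb.trans (hb X hX), fun u hu => (mem_filter.1 hu).2⟩

end Assembly

end RainbowTiling

open Finset RainbowTiling

theorem lemmaA1 (ε : ℝ) (hε : 0 < ε) :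
    ∃ φ₀ : ℝ, 0 < φ₀ ∧ ∀ φ : ℝ, 0 < φ → φ ≤ φ₀ →
      ∃ n₀ : ℕ, ∀ (V K : Type*) [Fintype V] [DecidableEq V]
        (G : SimpleGraph V) (c : G.EdgeLabeling K),
        n₀ ≤ Fintype.card V →
        (2 / 3 + ε) * (Fintype.card V : ℝ) ≤ (RainbowTiling.minColourDegree c : ℝ) →
        ∃ W : Finset V, (W.card : ℝ) ≤ ε * (Fintype.card V : ℝ) ∧
          RainbowTiling.HasPerfectRainbowTiling c 3 W ∧
          ∀ U : Finset V, Disjoint U W → (U.card : ℝ) ≤ φ * (Fintype.card V : ℝ) →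
            3 ∣ U.card → RainbowTiling.HasPerfectRainbowTiling c 3 (U ∪ W) := by
  classical
  obtain ⟨N, hN, η, hη, n₁, h_dens⟩ := exists_le_dens_absorbs hε
  have : Nonempty (Fin (3 * N)) := ⟨⟨0, by positivity⟩⟩
  obtain ⟨κ, hκ, hκη, hκε⟩ : ∃ κ : ℝ, 0 < κ ∧ 2 * Fintype.card (Fin (3 * N)) ^ 2 * κ ≤ η ∧
      Fintype.card (Fin (3 * N)) * κ ≤ ε :=
    ⟨min (η / (2 * Fintype.card (Fin (3 * N)) ^ 2)) (ε / Fintype.card (Fin (3 * N))),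
      by positivity, (le_div_iff₀' (by positivity)).1 (min_le_left _ _),
      (le_div_iff₀' (by positivity)).1 (min_le_right _ _)⟩
  obtain ⟨n₂, h_select⟩ := exists_forall_exists_pairwiseDisjoint (Fin (3 * N)) 3 hη hκ hκη
  refine ⟨3 * (η * κ / 8), by positivity, fun φ _ hφ => ⟨max n₁ n₂, fun V K _ _ G c hn hc => ?_⟩⟩
  obtain ⟨F, hF_card, hF_disj, hF⟩ := h_select V (le_of_max_le_right hn) _
    (h_dens V K G c (le_of_max_le_left hn) hc)
  obtain ⟨W, hW_card, hW, hW_union⟩ := exists_hasPerfectRainbowTiling_union three_pos hF_disj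
    (c := c) fun X hX => by simpa only [mem_filter_univ] using hF X hX
  refine ⟨W, ?_, hW, fun U hUW hU hU3 => hW_union U hUW (hU.trans ?_) hU3⟩
  · calc (#W : ℝ) ≤ #F * Fintype.card (Fin (3 * N)) := by exact_mod_cast hW_card
      _ ≤ κ * Fintype.card V * Fintype.card (Fin (3 * N)) := by gcongr
      _ = Fintype.card (Fin (3 * N)) * κ * Fintype.card V := by ring
      _ ≤ ε * Fintype.card V := by gcongr
  · push_cast
    rw [← mul_assoc]
    gcongr
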